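/- Let $k\ge 3$. A simplicial $k$-multicomplex is a finite multiset $\mathcal S$ of $(k+1)$-element sets (called $k$-simplices); its vertex set is $V(\mathcal S)=\bigcup_{S\in\mathcal S}S$, and its graph $G(\mathcal S)$ is the simple graph on $V(\mathcal S)$ in which two distinct vertices are adjacent if and only if some $k$-simplex of $\mathcal S$ contains both. It is a simplicial $k$-cycle if every $k$-element set is contained in an even number of members of $\mathcal S$ (counted with multiplicity), and a simplicial $k$-circuit if it is a nonempty simplicial $k$-cycle and no proper nonempty sub-multiset of it is a simplicial $k$-cycle. For a graph $G$ and distinct vertices $u,v$ of $G$ (adjacent or not), $G/uv$ is the simple graph obtained from $G-v$ by joining $u$ to every neighbour of $v$ other than $u$. A graph is $n$-connected if it has more than $n$ vertices and remains connected after the deletion of any fewer than $n$ vertices. A realisation of a graph $G=(V,E)$ in $\mathbb R^d$ is a map $p:V\to\mathbb R^d$; it is generic if the coordinates of the points $p(x)$, $x\in V$, are algebraically independent over $\mathbb Q$, and it is rigid if every continuous motion of the points that starts at $p$ and preserves the lengths of all edges of $G$ ends in a realisation congruent to $p$ (under an isometry of $\mathbb R^d$). The graph $G$ is rigid in $\mathbb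 R^d$ if some (equivalently, every) generic realisation of $G$ in $\mathbb R^d$ is rigid. The rigidity matrix $R(G,p)$ is the $|E|\times d|V|$ matrix whose row indexed by the edge $xy$ has $p(x)-p(y)$ in the $d$ columns of $x$, $p(y)-p(x)$ in the $d$ columns of $y$, and zeros elsewhere; $p$ is infinitesimally rigid if $\operatorname{rank}R(G,p)=d|V|-\binom{d+1}{2}$ when $|V|\ge d$, and $\operatorname{rank}R(G,p)=\binom{|V|}{2}$ when $|V|<d$. **Theorem.** Let $k\ge 3$, let $\mathcal S$ be a simplicial $k$-circuit, and let $u,v$ be distinct vertices of $\mathcal S$. Suppose that $G(\mathcal S)$ is $(k+2)$-connected and that $G(\mathcal S)/uv$ is rigid in $\mathbb R^{k+1}$. Then $G(\mathcal S)$ is $uv$-coincident rigid in $\mathbb R^{k+1}$, i.e. it has an infinitesimally rigid realisation $p$ in $\mathbb R^{k+1}$ with $p(u)=p(v)$. -/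

import Mathlib

noncomputable section

namespace SimplicialRigidity

/-! ### Simplicial multicomplexes, cycles and circuits -/

/-- A simplicial `k`-multicomplex: a multiset of `(k+1)`-element sets (its `k`-simplices). -/
def IsMulticomplex {α : Type*} (k : ℕ) (S : Multiset (Finset α)) : Prop :=
  ∀ U ∈ S, U.card = k + 1

/-- The vertex set `V(S)`, the union of all simplices of `S`. -/
def vertices {α : Type*} [DecidableEq α] (S : Multiset (Finset α)) : Finset α :=
  S.toFinset.biUnion id

/-- The boundary (over `ℤ/2`) of a simplicial `k`-multicomplex: the `k`-element subsets of `V(S)`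
contained in an odd number of simplices of `S`, counted with multiplicity. -/
def boundary {α : Type*} [DecidableEq α] (k : ℕ) (S : Multiset (Finset α)) : Set (Finset α) :=
  {F | F ⊆ vertices S ∧ F.card = k ∧ Odd (Multiset.card (S.filter fun U => F ⊆ U))}

/-- A simplicial `k`-cycle: a simplicial `k`-multicomplex with empty boundary. -/
def IsSimplicialCycle {α : Type*} [DecidableEq α] (k : ℕ) (S : Multiset (Finset α)) : Prop :=
  IsMulticomplex k S ∧ boundary k S = ∅

/-- A simplicial `k`-circuit: a nonempty simplicial `k`-cycle such that no proper nonempty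
subfamily is a simplicial `k`-cycle. -/
def IsSimplicialCircuit {α : Type*} [DecidableEq α] (k : ℕ) (S : Multiset (Finset α)) : Prop :=
  S ≠ 0 ∧ IsSimplicialCycle k S ∧ ∀ T < S, T ≠ 0 → ¬ IsSimplicialCycle k T

/-- The graph `G(S)`: vertex set `V(S)`, two distinct vertices being adjacent when they lie in a
common simplex of `S`. -/
def graph {α : Type*} [DecidableEq α] (S : Multiset (Finset α)) :
    SimpleGraph {x : α // x ∈ vertices S} where
  Adj x y := x ≠ y ∧ ∃ U ∈ S, (x : α) ∈ U ∧ (y : α) ∈ U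
  symm := ⟨fun _ _ ⟨h, U, hU, hx, hy⟩ => ⟨h.symm, U, hU, hy, hx⟩⟩
  loopless := ⟨fun _ h => h.1 rfl⟩

/-! ### Graphs -/

/-- `G` is `n`-connected: it has more than `n` vertices, and deleting fewer than `n` vertices
never disconnects it. -/
def IsKConnected {V : Type*} (n : ℕ) (G : SimpleGraph V) : Prop :=
  n < Nat.card V ∧ ∀ X : Finset V, X.card < n → (G.induce {x | x ∉ X}).Connected

/-- The graph `G/uv` obtained from `G` by contracting `v` onto `u`: delete `v`, then join `u` to
every neighbour of `v` other than `u` (the vertices `u` and `v` need not be adjacent). -/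
def contract {V : Type*} (G : SimpleGraph V) (u v : V) : SimpleGraph {x : V // x ≠ v} where
  Adj x y := x ≠ y ∧
    (G.Adj x y ∨ ((x : V) = u ∧ G.Adj v y) ∨ ((y : V) = u ∧ G.Adj v x))
  symm := ⟨fun _ _ ⟨h, h'⟩ => ⟨h.symm, h'.imp (fun a => a.symm) Or.symm⟩⟩
  loopless := ⟨fun _ h => h.1 rfl⟩

/-! ### Frameworks and rigidity -/

/-- Two realisations are congruent if some isometry of `ℝ^d` takes one to the other. -/
def IsCongruent {V : Type*} {d : ℕ} (p q : V → EuclideanSpace ℝ (Fin d)) : Prop :=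
  ∃ φ : EuclideanSpace ℝ (Fin d) ≃ᵢ EuclideanSpace ℝ (Fin d), ∀ x, q x = φ (p x)

/-- The framework `(G, p)` is rigid: every continuous motion of the vertices starting at `p` which
preserves the edge lengths ends in a framework congruent to `(G, p)`. -/
def IsRigidFramework {V : Type*} {d : ℕ} (G : SimpleGraph V)
    (p : V → EuclideanSpace ℝ (Fin d)) : Prop :=
  ∀ γ : unitInterval → V → EuclideanSpace ℝ (Fin d), Continuous γ → γ 0 = p →
    (∀ t x y, G.Adj x y → dist (γ t x) (γ t y) = dist (p x) (p y)) → IsCongruent p (γ 1)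

/-- A realisation is generic if the family of all coordinates of its points is algebraically
independent over `ℚ`. -/
def IsGeneric {V : Type*} {d : ℕ} (p : V → EuclideanSpace ℝ (Fin d)) : Prop :=
  AlgebraicIndependent ℚ fun i : V × Fin d => p i.1 i.2

/-- `G` is rigid in `ℝ^d` if some generic realisation of `G` in `ℝ^d` is rigid. -/
def IsRigid {V : Type*} (d : ℕ) (G : SimpleGraph V) : Prop :=
  ∃ p : V → EuclideanSpace ℝ (Fin d), IsGeneric p ∧ IsRigidFramework G p

/-- The rigidity matrix `R(G, p)`: the row of the edge `xy` has `p x - p y` in the columns of `x`,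
`p y - p x` in the columns of `y`, and zeros elsewhere. -/
def rigidityMatrix {V : Type*} [DecidableEq V] {d : ℕ} (G : SimpleGraph V)
    (p : V → EuclideanSpace ℝ (Fin d)) : Matrix G.edgeSet (V × Fin d) ℝ :=
  Matrix.of fun e c =>
    Sym2.lift ⟨fun x y =>
      (if c.1 = x then p x c.2 - p y c.2 else 0) + (if c.1 = y then p y c.2 - p x c.2 else 0),
      fun _ _ => add_comm _ _⟩ (e : Sym2 V)

/-- `(G, p)` is infinitesimally rigid in `ℝ^d`: the rank of the rigidity matrix is
`d |V| - (d+1 choose 2)` if `|V| ≥ d`, and `(|V| choose 2)` if `|V| < d`. In the first case the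
subtraction does not truncate. -/
def IsInfinitesimallyRigid {V : Type*} [Fintype V] [DecidableEq V] {d : ℕ} (G : SimpleGraph V)
    (p : V → EuclideanSpace ℝ (Fin d)) : Prop :=
  (rigidityMatrix G p).rank =
    if d ≤ Fintype.card V then d * Fintype.card V - (d + 1).choose 2
    else (Fintype.card V).choose 2

end SimplicialRigidity

end

/-! Write `k = j + 1` and `d = j + 2`. Place the vertices of `G/uv` generically and put `v` at the
point of `u`; it has to be shown that every velocity field `q` preserving the edge lengths to first
order is a trivial motion. There are two cases, according to the number of common neighbours of `u`
and `v`.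

With at least `d` common neighbours, `q u - q v` is orthogonal to `d` independent directions, so `q
u = q v` and `q` descends to `G/uv`. A generic rigid framework is infinitesimally rigid
(`IsRigidFramework.inner_eq_zero`), so `q` is trivial.

With at most `j + 1` common neighbours, suppose first that `u` and `v` are not adjacent, and let `D`
be a set of `j + 1` vertices containing the common neighbours. A vertex `w` outside `D` does not see
both `u` and `v`, so its star is placed generically. Its link is a `j`-cycle, hence a disjoint union
of `j`-circuits, and the cone over each of them is rigid (`IsCirc.infRigidOn_cone`). Therefore each
simplex moves as a rigid body, and the simplices moving with one fixed trivial motion form a chain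
whose boundary can only be the single face `D`. Since a boundary has zero boundary, that chain is a
cycle, and by minimality it is the whole circuit. If `u` and `v` are adjacent, the simplices through
`uv` are removed by adding, modulo two, the boundary of the simplex on `D ∪ {u, v}`. The new cycle
may carry two different motions, and this is excluded by connectivity.

Rigidity of cones is Fogelsanger's argument: contract an edge `xy` of the circuit, split the
simplices not through `xy` into minimal families that contract to cycles, obtain each family's
rigidity by induction and vertex splitting (`InfRigidOn.vertex_split`), and glue by the same
principle that the simplices sharing a motion form a cycle. -/

namespace SimplicialRigidity
open Matrix

/-! ### Rank of matrices depending on parameters -/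

theorem exists_submatrix_det_ne_zero {m n : Type*} [Fintype m] [Fintype n] {K : Type*} [Field K]
    (A : Matrix m n K) :
    ∃ (r : Fin A.rank → m) (c : Fin A.rank → n), (A.submatrix r c).det ≠ 0 := by
  have h1 := Submodule.exists_fun_fin_finrank_span_eq K (Set.range A.row)
  rw [← Matrix.rank_eq_finrank_span_row] at h1
  obtain ⟨f, hf, -, hfi⟩ := h1
  choose r hr using hf
  set B : Matrix (Fin A.rank) n K := A.submatrix r id with hB
  have hBrow : B.row = f := by
    funext i; rw [← hr i]; rfl
  have hBrank : B.rank = A.rank := by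
    have := LinearIndependent.rank_matrix (M := B) (by rw [hBrow]; exact hfi)
    simpa using this
  have h2 := Submodule.exists_fun_fin_finrank_span_eq K (Set.range B.col)
  rw [← Matrix.rank_eq_finrank_span_cols, hBrank] at h2
  obtain ⟨g, hg, -, hgi⟩ := h2
  choose c hc using hg
  refine ⟨r, c, ?_⟩
  have h3 : (A.submatrix r c).col = g := by
    funext i; rw [← hc i]; rfl
  have h4 : IsUnit (A.submatrix r c) := by
    rw [← Matrix.linearIndependent_cols_iff_isUnit, h3]; exact hgi
  exact ((Matrix.isUnit_iff_isUnit_det _).1 h4).ne_zero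

theorem le_rank_of_submatrix_det_ne_zero {m n : Type*} [Fintype m] [Fintype n] {K : Type*} [Field K]
    (A : Matrix m n K) {k : ℕ} (r : Fin k → m) (c : Fin k → n)
    (h : (A.submatrix r c).det ≠ 0) : k ≤ A.rank := by
  have h1 := Matrix.rank_of_det_ne_zero h
  have h2 := Matrix.eRank_submatrix_le A r c
  have h3 := ENat.toNat_le_toNat h2 (ne_top_of_le_ne_top (by simp : ENat.card n ≠ ⊤) A.eRank_le_card_width)
  rw [Matrix.eRank_toNat_eq_rank, Matrix.eRank_toNat_eq_rank, h1] at h3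
  simpa using h3

/-- A minor that is nonzero at `a` is a nonzero polynomial, and so it cannot vanish at algebraically
independent `b`. This is how rigidity passes from special positions to generic ones. -/
theorem rank_aeval_le {σ m n : Type*} [Fintype m] [Fintype n]
    (M : Matrix m n (MvPolynomial σ ℚ)) (a b : σ → ℝ) (hb : AlgebraicIndependent ℚ b) :
    (M.map (MvPolynomial.aeval a)).rank ≤ (M.map (MvPolynomial.aeval b)).rank := by
  obtain ⟨r, c, h⟩ := exists_submatrix_det_ne_zero (M.map (MvPolynomial.aeval a : _ →ₐ[ℚ] ℝ))
  refine le_rank_of_submatrix_det_ne_zero _ r c ?_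
  have key : ∀ z : σ → ℝ, ((M.map (MvPolynomial.aeval z : _ →ₐ[ℚ] ℝ)).submatrix r c).det
      = MvPolynomial.aeval z (M.submatrix r c).det := fun z => by
    rw [AlgHom.map_det]; rfl
  rw [key] at h ⊢
  intro h0
  apply h
  have := (algebraicIndependent_iff.1 hb) _ h0
  rw [this, map_zero]

theorem eventually_rank_le {m n X : Type*} [Fintype m] [Fintype n] [TopologicalSpace X]
    (M : X → Matrix m n ℝ) (hM : Continuous M) (x : X) :
    ∀ᶠ y in nhds x, (M x).rank ≤ (M y).rank := by
  obtain ⟨r, c, h⟩ := exists_submatrix_det_ne_zero (M x)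
  have hc : Continuous fun y => ((M y).submatrix r c).det := (hM.matrix_submatrix r c).matrix_det
  filter_upwards [hc.continuousAt.eventually_ne h] with y hy
  exact le_rank_of_submatrix_det_ne_zero _ r c hy

/-! ### Trivial motions and generic point sets -/

abbrev E (d : ℕ) := EuclideanSpace ℝ (Fin d)

/-- The infinitesimal isometries `x ↦ M x + t`, with `M` skew, of `ℝ^d`. -/
def trivialMotions (d : ℕ) : Submodule ℝ ((E d →ₗ[ℝ] E d) × E d) where
  carrier := {τ | ∀ x, inner ℝ (τ.1 x) x = 0}
  add_mem' := by
    intro a b ha hb x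
    simp only [Set.mem_ofPred_eq] at ha hb
    simp [inner_add_left, ha, hb]
  zero_mem' := by intro x; simp
  smul_mem' := by
    intro c a ha x
    simp only [Set.mem_ofPred_eq] at ha
    simp [inner_smul_left, ha]

theorem inner_trivialMotion {d : ℕ} {τ : (E d →ₗ[ℝ] E d) × E d} (hτ : τ ∈ trivialMotions d)
    (x y : E d) : inner ℝ (τ.1 x) y = - inner ℝ x (τ.1 y) := by
  have h1 := hτ (x + y)
  have h2 := hτ x
  have h3 := hτ y
  simp only [map_add, inner_add_left, inner_add_right, h2, h3] at h1
  rw [real_inner_comm y (τ.1 x), real_inner_comm (τ.1 y) x]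
  rw [real_inner_comm y (τ.1 x)] at h1
  linarith

/-- The velocities `q` agree on `A` with a single trivial motion. -/
def IsBody {α : Type*} {d : ℕ} (p q : α → E d) (A : Finset α) : Prop :=
  ∃ τ ∈ trivialMotions d, ∀ a ∈ A, q a = τ.1 (p a) + τ.2

/-- The points `p a`, `a ∈ A`, have algebraically independent coordinates. -/
def GenOn {α : Type*} {d : ℕ} (p : α → E d) (A : Finset α) : Prop :=
  AlgebraicIndependent ℚ fun i : A × Fin d => p i.1 i.2

theorem GenOn.of_injOn {α : Type*} {d : ℕ} {p p' : α → E d} {A B : Finset α} (h : GenOn p A)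
    (f : α → α) (hf : Set.InjOn f B) (hm : ∀ b ∈ B, f b ∈ A) (hp : ∀ b ∈ B, p' b = p (f b)) :
    GenOn p' B := by
  have := AlgebraicIndependent.comp h
    (fun i : B × Fin d => ((⟨f i.1, hm _ i.1.2⟩ : A), i.2)) (by
      rintro ⟨⟨a, ha⟩, i⟩ ⟨⟨b, hb⟩, j⟩ hab
      simp only [Prod.mk.injEq, Subtype.mk.injEq] at hab
      simp [hf ha hb hab.1, hab.2])
  have e : (fun i : B × Fin d => p' i.1 i.2) = fun i : B × Fin d => p (f i.1) i.2 := by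
    funext i; rw [hp _ i.1.2]
  unfold GenOn
  rw [e]
  exact this

theorem GenOn.mono {α : Type*} {d : ℕ} {p : α → E d} {A B : Finset α} (h : GenOn p A)
    (hBA : B ⊆ A) : GenOn p B :=
  h.of_injOn id (Set.injOn_id _) (fun _ hb => hBA hb) (fun _ _ => rfl)

/-- It suffices to exhibit one placement with independent differences: `a₀` at the origin and the
other points at distinct standard basis vectors. Generic points have at least that rank. -/
theorem GenOn.linearIndependent {α : Type*} [DecidableEq α] {d : ℕ} {p : α → E d} {A : Finset α}
    (h : GenOn p A) (hA : A.card ≤ d + 1) {a₀ : α} (ha₀ : a₀ ∈ A) :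
    LinearIndependent ℝ fun a : {x // x ∈ A.erase a₀} => p a - p a₀ := by
  classical
  have hcard : Fintype.card {x // x ∈ A.erase a₀} ≤ Fintype.card (Fin d) := by
    rw [Fintype.card_coe, Finset.card_erase_of_mem ha₀, Fintype.card_fin]; omega
  obtain ⟨g⟩ := Function.Embedding.nonempty_of_card_le hcard
  have hmem : ∀ a : {x // x ∈ A.erase a₀}, (a : α) ∈ A := fun a => Finset.mem_of_mem_erase a.2
  let N : Matrix {x // x ∈ A.erase a₀} (Fin d) (MvPolynomial (A × Fin d) ℚ) :=
    Matrix.of fun a i => MvPolynomial.X (⟨a, hmem a⟩, i) - MvPolynomial.X (⟨a₀, ha₀⟩, i)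
  let s : A × Fin d → ℝ := fun z =>
    if hz : (z.1 : α) ∈ A.erase a₀ then (if g ⟨z.1, hz⟩ = z.2 then 1 else 0) else 0
  have hle := rank_aeval_le N s _ h
  have h1 : (N.map (MvPolynomial.aeval s : _ →ₐ[ℚ] ℝ)).row =
      fun a => Pi.basisFun ℝ (Fin d) (g a) := by
    funext a i
    simp only [N, s, Matrix.row, Pi.basisFun_apply, Pi.single_apply, Matrix.map_apply,
      Matrix.of_apply, map_sub, MvPolynomial.aeval_X, Subtype.coe_eta, a.2, dif_pos,
      Finset.notMem_erase, dif_neg, not_false_eq_true, sub_zero, eq_comm (a := i)]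
  have h2 : (N.map (MvPolynomial.aeval s : _ →ₐ[ℚ] ℝ)).rank =
      Fintype.card {x // x ∈ A.erase a₀} := by
    apply LinearIndependent.rank_matrix
    rw [h1]
    exact (Pi.basisFun ℝ (Fin d)).linearIndependent.comp g g.injective
  rw [h2, Matrix.rank_eq_finrank_span_row] at hle
  have h3 := linearIndependent_iff_card_le_finrank_span.2 hle
  have h4 : (fun a : {x // x ∈ A.erase a₀} => p a - p a₀) =
      (WithLp.linearEquiv 2 ℝ (Fin d → ℝ)).symm ∘
        (N.map (MvPolynomial.aeval fun i : A × Fin d => p i.1 i.2 : _ →ₐ[ℚ] ℝ)).row := by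
    funext a
    ext i
    change p a i - p a₀ i = MvPolynomial.aeval (R := ℚ) (fun i : A × Fin d => p i.1 i.2)
      (MvPolynomial.X ((⟨a, hmem a⟩ : A), i) - MvPolynomial.X ((⟨a₀, ha₀⟩ : A), i))
    simp
  rw [h4]
  exact h3.map' ((WithLp.linearEquiv 2 ℝ (Fin d → ℝ)).symm : (Fin d → ℝ) →ₗ[ℝ] E d)
    (LinearEquiv.ker _)

theorem GenOn.eq_zero_of_inner {α : Type*} [DecidableEq α] {d : ℕ} {p : α → E d} {A : Finset α}
    (h : GenOn p A) (hA : A.card = d + 1) {a₀ : α} (ha₀ : a₀ ∈ A) {z : E d}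
    (hz : ∀ a ∈ A, inner ℝ (p a - p a₀) z = 0) : z = 0 := by
  have hli := h.linearIndependent hA.le ha₀
  have hsp := hli.span_eq_top_of_card_eq_finrank' (by
    rw [Fintype.card_coe, Finset.card_erase_of_mem ha₀, hA]; simp)
  have : ∀ x ∈ Submodule.span ℝ (Set.range fun a : {x // x ∈ A.erase a₀} => p a - p a₀),
      inner ℝ x z = 0 := by
    intro x hx
    induction hx using Submodule.span_induction with
    | mem x hx => obtain ⟨a, rfl⟩ := hx; exact hz _ (Finset.mem_of_mem_erase a.2)
    | zero => simp
    | add x y _ _ hx hy => simp [inner_add_left, hx, hy]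
    | smul c x _ hx => simp [inner_smul_left, hx]
  have h0 := this z (by rw [hsp]; trivial)
  exact inner_self_eq_zero.1 h0

/-- Here `d` points suffice although they only span a hyperplane. The skew part kills a space of
dimension at least `d - 1`, its image is orthogonal to its kernel and so lies in a line, and a skew
map carrying that line into itself is zero on it. -/
theorem GenOn.trivialMotion_eq_zero {α : Type*} [DecidableEq α] {d : ℕ} {p : α → E d}
    {A : Finset α} (h : GenOn p A) (hd : 0 < d) (hA : d ≤ A.card)
    {τ : (E d →ₗ[ℝ] E d) × E d} (hτ : τ ∈ trivialMotions d)
    (h0 : ∀ a ∈ A, τ.1 (p a) + τ.2 = 0) : τ = 0 := by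
  obtain ⟨B, hBA, hB⟩ := Finset.exists_subset_card_eq hA
  obtain ⟨a₀, ha₀⟩ : B.Nonempty := Finset.card_pos.1 (by omega)
  have hli := (h.mono hBA).linearIndependent (by omega) ha₀
  have hker : Submodule.span ℝ (Set.range fun a : {x // x ∈ B.erase a₀} => p a - p a₀) ≤
      LinearMap.ker τ.1 := by
    rw [Submodule.span_le]
    rintro _ ⟨a, rfl⟩
    have h1 := h0 a (hBA (Finset.mem_of_mem_erase a.2))
    have h2 := h0 a₀ (hBA ha₀)
    simp only [SetLike.mem_coe, LinearMap.mem_ker, map_sub]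
    have : τ.1 (p a) - τ.1 (p a₀) = (τ.1 (p a) + τ.2) - (τ.1 (p a₀) + τ.2) := by abel
    rw [this, h1, h2, sub_zero]
  have hfin : d - 1 ≤ Module.finrank ℝ (LinearMap.ker τ.1) := by
    have := Submodule.finrank_mono hker
    rw [finrank_span_eq_card hli, Fintype.card_coe, Finset.card_erase_of_mem ha₀, hB] at this
    exact this
  have horth : Module.finrank ℝ (LinearMap.ker τ.1)ᗮ ≤ 1 := by
    have := Submodule.finrank_add_finrank_orthogonal (LinearMap.ker τ.1)
    rw [finrank_euclideanSpace_fin] at this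
    omega
  have hran : ∀ x, τ.1 x ∈ (LinearMap.ker τ.1)ᗮ := by
    intro x
    rw [Submodule.mem_orthogonal]
    intro y hy
    rw [real_inner_comm, inner_trivialMotion hτ, LinearMap.mem_ker.1 hy]
    simp
  have hM : τ.1 = 0 := by
    ext1 x
    by_contra hx
    rw [LinearMap.zero_apply] at hx
    obtain ⟨c, hc⟩ := (finrank_eq_one_iff_of_nonzero' (⟨τ.1 x, hran x⟩ : (LinearMap.ker τ.1)ᗮ)
      (by simpa [Subtype.ext_iff] using hx)).1 (le_antisymm horth (by
        rw [Nat.succ_le_iff, Module.finrank_pos_iff_exists_ne_zero]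
        exact ⟨⟨τ.1 x, hran x⟩, by simpa [Subtype.ext_iff] using hx⟩)) ⟨τ.1 (τ.1 x), hran _⟩
    have hc' : c • τ.1 x = τ.1 (τ.1 x) := congrArg Subtype.val hc
    have h1 := hτ (τ.1 x)
    rw [← hc', inner_smul_left] at h1
    rcases mul_eq_zero.1 h1 with hc0 | hx0
    · have hc0 : c = 0 := by simpa using hc0
      have h2 : τ.1 x ∈ LinearMap.ker τ.1 := by
        rw [LinearMap.mem_ker, ← hc', hc0, zero_smul]
      exact hx (inner_self_eq_zero.1 ((Submodule.mem_orthogonal _ _).1 (hran x) _ h2))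
    · exact hx (inner_self_eq_zero.1 hx0)
  have ht := h0 a₀ (hBA ha₀)
  rw [hM, LinearMap.zero_apply, zero_add] at ht
  exact Prod.ext hM ht

theorem GenOn.trivialMotion_unique {α : Type*} [DecidableEq α] {d : ℕ} {p : α → E d}
    {A : Finset α} (h : GenOn p A) (hd : 0 < d) (hA : d ≤ A.card)
    {τ σ : (E d →ₗ[ℝ] E d) × E d} (hτ : τ ∈ trivialMotions d) (hσ : σ ∈ trivialMotions d)
    (h0 : ∀ a ∈ A, τ.1 (p a) + τ.2 = σ.1 (p a) + σ.2) : τ = σ := by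
  rw [← sub_eq_zero]
  refine h.trivialMotion_eq_zero hd hA (Submodule.sub_mem _ hτ hσ) fun a ha => ?_
  have := h0 a ha
  simp only [Prod.fst_sub, Prod.snd_sub, LinearMap.sub_apply]
  rw [← sub_eq_zero] at this
  rw [← this]; abel

theorem IsBody.inner_eq_zero {α : Type*} {d : ℕ} {p q : α → E d} {A : Finset α}
    (h : IsBody p q A) {a b : α} (ha : a ∈ A) (hb : b ∈ A) :
    inner ℝ (p a - p b) (q a - q b) = 0 := by
  obtain ⟨τ, hτ, hq⟩ := h
  have := hτ (p a - p b)
  rw [hq a ha, hq b hb, real_inner_comm, ← this, map_sub]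
  congr 1; abel

/-- The differences `p a - p a₀` form a basis, so exactly one linear map sends them to the
differences of velocities. By polarisation the length conditions say that this map is skew. -/
theorem GenOn.isBody_of_card_eq {α : Type*} [DecidableEq α] {d : ℕ} {p q : α → E d}
    {A : Finset α} (h : GenOn p A) (hA : A.card = d + 1)
    (hq : ∀ a ∈ A, ∀ b ∈ A, inner ℝ (p a - p b) (q a - q b) = 0) : IsBody p q A := by
  obtain ⟨a₀, ha₀⟩ : A.Nonempty := Finset.card_pos.1 (by omega)
  have hli := h.linearIndependent hA.le ha₀
  have hsp := hli.span_eq_top_of_card_eq_finrank' (by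
    rw [Fintype.card_coe, Finset.card_erase_of_mem ha₀, hA]; simp)
  let b := Module.Basis.mk hli hsp.ge
  have hb : ∀ a, b a = p a - p a₀ := fun a => by simp [b]
  let N : E d →ₗ[ℝ] E d := b.constr ℝ fun a => q a - q a₀
  have hN : ∀ a, N (b a) = q a - q a₀ := fun a => by simp [N]
  have hpair : ∀ i j, inner ℝ (N (b i)) (b j) + inner ℝ (b i) (N (b j)) = 0 := by
    intro i j
    have hi := Finset.mem_of_mem_erase i.2
    have hj := Finset.mem_of_mem_erase j.2
    have h1 := hq i hi a₀ ha₀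
    have h2 := hq j hj a₀ ha₀
    have h3 := hq i hi j hj
    rw [hN, hN, hb, hb]
    have e1 : p i - p j = (p i - p a₀) - (p j - p a₀) := by abel
    have e2 : q i - q j = (q i - q a₀) - (q j - q a₀) := by abel
    rw [e1, e2, inner_sub_left, inner_sub_right _ (q i - q a₀), inner_sub_right _ (q i - q a₀),
      h1, h2] at h3
    rw [real_inner_comm (p j - p a₀)]
    linarith
  have h1 : ∀ i y, inner ℝ (N (b i)) y + inner ℝ (b i) (N y) = 0 := by
    intro i y
    have : (innerₛₗ ℝ (N (b i)) + (innerₛₗ ℝ (b i)).comp N : E d →ₗ[ℝ] ℝ) = 0 :=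
      b.ext fun j => by simpa using hpair i j
    simpa using LinearMap.congr_fun this y
  have h2 : ∀ x y, inner ℝ (N x) y + inner ℝ x (N y) = 0 := by
    intro x y
    have : ((innerₛₗ ℝ y).comp N + innerₛₗ ℝ (N y) : E d →ₗ[ℝ] ℝ) = 0 :=
      b.ext fun j => by
        have := h1 j y
        rw [real_inner_comm, real_inner_comm (N y)] at this
        simpa using this
    have := LinearMap.congr_fun this x
    rw [real_inner_comm, real_inner_comm (N y)]
    simpa using this
  refine ⟨(N, q a₀ - N (p a₀)), fun x => ?_, fun a ha => ?_⟩
  · have := h2 x x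
    rw [real_inner_comm (N x) x] at this
    change inner ℝ (N x) x = 0
    linarith
  · by_cases haa : a = a₀
    · subst haa; simp
    · have := hN ⟨a, Finset.mem_erase.2 ⟨haa, ha⟩⟩
      rw [hb, map_sub] at this
      change q a = N (p a) + (q a₀ - N (p a₀))
      have h5 : N (p a) = q a - q a₀ + N (p a₀) := by rw [← this]; abel
      rw [h5]; abel

/-- A simplex on `d + 1` of the points determines the motion. The error in the velocity of a further
point `z` is orthogonal to every `p z - p a`, whose differences span the space. -/
theorem GenOn.isBody {α : Type*} [DecidableEq α] {d : ℕ} {p q : α → E d}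
    {A : Finset α} (h : GenOn p A) (hA : d + 1 ≤ A.card)
    (hq : ∀ a ∈ A, ∀ b ∈ A, inner ℝ (p a - p b) (q a - q b) = 0) : IsBody p q A := by
  obtain ⟨B, hBA, hB⟩ := Finset.exists_subset_card_eq hA
  obtain ⟨τ, hτ, hτB⟩ := (h.mono hBA).isBody_of_card_eq hB
    fun a ha b hb => hq a (hBA ha) b (hBA hb)
  refine ⟨τ, hτ, fun z hz => ?_⟩
  obtain ⟨a₀, ha₀⟩ : B.Nonempty := Finset.card_pos.1 (by omega)
  have key : ∀ a ∈ B, inner ℝ (p z - p a) (q z - (τ.1 (p z) + τ.2)) = 0 := by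
    intro a ha
    have h1 := hq z hz a (hBA ha)
    have h2 := hτ (p z - p a)
    rw [hτB a ha] at h1
    rw [real_inner_comm] at h2
    have e : q z - (τ.1 (p z) + τ.2) = (q z - (τ.1 (p a) + τ.2)) - τ.1 (p z - p a) := by
      rw [map_sub]; abel
    rw [e, inner_sub_right, h1, h2, sub_zero]
  have := (h.mono hBA).eq_zero_of_inner hB ha₀ (z := q z - (τ.1 (p z) + τ.2)) fun a ha => by
    have e : p a - p a₀ = (p z - p a₀) - (p z - p a) := by abel
    rw [e, inner_sub_left, key a ha, key a₀ ha₀, sub_zero]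
  exact sub_eq_zero.1 this

/-! ### Spaces of infinitesimal motions -/

section Motions

variable {V : Type*} {d : ℕ}

/-- The matrix whose row `(x, y)` is the functional `q ↦ ⟪ε x y, q x - q y⟫`. -/
def bondMatrix [DecidableEq V] (ε : V → V → E d) : Matrix (V × V) (V × Fin d) ℝ :=
  Matrix.of fun e c =>
    (if c.1 = e.1 then ε e.1 e.2 c.2 else 0) - (if c.1 = e.2 then ε e.1 e.2 c.2 else 0)

/-- The bond directions are arbitrary rather than `p x - p y`, so that an edge of length zero may
still be given a direction; vertex splitting needs this. -/
def motions (ε : V → V → E d) : Submodule ℝ (V → E d) where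
  carrier := {q | ∀ x y, inner ℝ (ε x y) (q x - q y) = 0}
  add_mem' := by
    intro a b ha hb x y
    have e : (a + b) x - (a + b) y = (a x - a y) + (b x - b y) := by
      simp only [Pi.add_apply]; abel
    rw [e, inner_add_right, ha, hb, add_zero]
  zero_mem' := by intro x y; simp
  smul_mem' := by
    intro c a ha x y
    rw [Pi.smul_apply, Pi.smul_apply, ← smul_sub, inner_smul_right, ha, mul_zero]

theorem mem_motions {ε : V → V → E d} {q : V → E d} :
    q ∈ motions ε ↔ ∀ x y, inner ℝ (ε x y) (q x - q y) = 0 := Iff.rfl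

def flattenEquiv (V : Type*) (d : ℕ) : (V → E d) ≃ₗ[ℝ] (V × Fin d → ℝ) :=
  (LinearEquiv.piCongrRight fun _ => WithLp.linearEquiv 2 ℝ (Fin d → ℝ)).trans
    (LinearEquiv.curry ℝ ℝ V (Fin d)).symm

theorem flattenEquiv_apply (q : V → E d) (c : V × Fin d) : flattenEquiv V d q c = q c.1 c.2 := rfl

theorem inner_eq_sum (x y : E d) : inner ℝ x y = ∑ i, x i * y i := by
  simp [PiLp.inner_apply, mul_comm]

theorem bondMatrix_mulVec [Fintype V] [DecidableEq V] (ε : V → V → E d) (q : V → E d)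
    (e : V × V) :
    (bondMatrix ε *ᵥ flattenEquiv V d q) e = inner ℝ (ε e.1 e.2) (q e.1 - q e.2) := by
  simp only [Matrix.mulVec, dotProduct, bondMatrix, Matrix.of_apply, flattenEquiv_apply,
    Fintype.sum_prod_type, sub_mul, Finset.sum_sub_distrib, ite_mul, zero_mul]
  rw [Finset.sum_comm, Finset.sum_comm (f := fun z i => if z = e.2 then _ else _)]
  simp [inner_sub_right, inner_eq_sum]

theorem finrank_motions_add_rank [Fintype V] [DecidableEq V] (ε : V → V → E d) :
    Module.finrank ℝ (motions ε) + (bondMatrix ε).rank = d * Fintype.card V := by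
  have h1 : motions ε = (LinearMap.ker (bondMatrix ε).mulVecLin).map
      ((flattenEquiv V d).symm : (V × Fin d → ℝ) →ₗ[ℝ] (V → E d)) := by
    rw [Submodule.map_equiv_eq_comap_symm]
    ext q
    simp only [mem_motions, LinearEquiv.symm_symm, Submodule.mem_comap, LinearMap.mem_ker,
      Matrix.mulVecLin_apply, LinearEquiv.coe_coe]
    rw [funext_iff, Prod.forall]
    simp only [bondMatrix_mulVec, Pi.zero_apply]
  rw [h1, LinearEquiv.finrank_map_eq]
  have := LinearMap.finrank_range_add_finrank_ker (bondMatrix ε).mulVecLin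
  rw [Module.finrank_fintype_fun_eq_card, Fintype.card_prod, Fintype.card_fin] at this
  rw [mul_comm, ← this, add_comm]
  rfl

def trivialVelocities (p : V → E d) : trivialMotions d →ₗ[ℝ] (V → E d) where
  toFun τ x := τ.1.1 (p x) + τ.1.2
  map_add' := by intro a b; funext x; simp; abel
  map_smul' := by intro a b; funext x; simp

open Classical in
/-- The bonds of the framework `(adj, p)`. -/
noncomputable def bonds (adj : V → V → Prop) (p : V → E d) (x y : V) : E d := if adj x y then p x - p y else 0

theorem mem_motions_bonds {adj : V → V → Prop} {p q : V → E d} :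
    q ∈ motions (bonds adj p) ↔ ∀ x y, adj x y → inner ℝ (p x - p y) (q x - q y) = 0 := by
  rw [mem_motions]
  refine forall_congr' fun x => forall_congr' fun y => ?_
  unfold bonds
  split_ifs with h <;> simp [h]

theorem range_trivialVelocities_le (adj : V → V → Prop) (p : V → E d) :
    LinearMap.range (trivialVelocities p) ≤ motions (bonds adj p) := by
  rintro _ ⟨τ, rfl⟩
  rw [mem_motions_bonds]
  intro x y _
  have := τ.2 (p x - p y)
  rw [real_inner_comm, map_sub] at this
  rw [← this]
  congr 1
  simp [trivialVelocities]

theorem rank_bondMatrix_le [Fintype V] [DecidableEq V] (adj : V → V → Prop) (p b : V → E d)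
    (hb : AlgebraicIndependent ℚ fun i : V × Fin d => b i.1 i.2) :
    (bondMatrix (bonds adj p)).rank ≤ (bondMatrix (bonds adj b)).rank := by
  classical
  let N : Matrix (V × V) (V × Fin d) (MvPolynomial (V × Fin d) ℚ) := Matrix.of fun e c =>
    if adj e.1 e.2 then
      (if c.1 = e.1 then MvPolynomial.X (e.1, c.2) - MvPolynomial.X (e.2, c.2) else 0) -
      (if c.1 = e.2 then MvPolynomial.X (e.1, c.2) - MvPolynomial.X (e.2, c.2) else 0)
    else 0
  have key : ∀ z : V → E d, N.map (MvPolynomial.aeval fun i : V × Fin d => z i.1 i.2 :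
      _ →ₐ[ℚ] ℝ) = bondMatrix (bonds adj z) := by
    intro z
    ext e c
    simp only [N, Matrix.map_apply, Matrix.of_apply, bondMatrix, bonds]
    split_ifs <;> simp
  rw [← key, ← key]
  exact rank_aeval_le N _ _ hb

theorem finrank_motions_le [Fintype V] [DecidableEq V] (adj : V → V → Prop) (p b : V → E d)
    (hb : AlgebraicIndependent ℚ fun i : V × Fin d => b i.1 i.2) :
    Module.finrank ℝ (motions (bonds adj b)) ≤ Module.finrank ℝ (motions (bonds adj p)) := by
  have h1 := rank_bondMatrix_le adj p b hb
  have h2 := finrank_motions_add_rank (bonds adj p)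
  have h3 := finrank_motions_add_rank (bonds adj b)
  omega

end Motions

/-! ### Infinitesimal rigidity on a finite set of vertices -/

section Rigid

variable {α : Type*} {d : ℕ}

/-- Phrased through velocities instead of ranks, so that rigid pieces can be glued by comparing
their trivial motions. -/
def InfRigidOn (adj : α → α → Prop) (A : Finset α) (p : α → E d) : Prop :=
  ∀ q : α → E d, (∀ x ∈ A, ∀ y ∈ A, adj x y → inner ℝ (p x - p y) (q x - q y) = 0) → IsBody p q A

theorem infRigidOn_iff {adj : α → α → Prop} {A : Finset α} {p : α → E d} :
    InfRigidOn adj A p ↔ motions (bonds (fun x y : A => adj x y) fun x : A => p x) ≤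
      LinearMap.range (trivialVelocities fun x : A => p x) := by
  classical
  constructor
  · intro h q hq
    rw [mem_motions_bonds] at hq
    obtain ⟨τ, hτ, hqτ⟩ := h (fun a => if h : a ∈ A then q ⟨a, h⟩ else 0) (by
      intro x hx y hy hxy
      simpa [hx, hy] using hq ⟨x, hx⟩ ⟨y, hy⟩ hxy)
    refine ⟨⟨τ, hτ⟩, ?_⟩
    funext x
    have := hqτ x x.2
    simpa [x.2, trivialVelocities] using this.symm
  · intro h q hq
    obtain ⟨τ, hτ⟩ := h (show (fun x : A => q x) ∈ _ by
      rw [mem_motions_bonds]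
      intro x y hxy
      exact hq x x.2 y y.2 hxy)
    exact ⟨τ.1, τ.2, fun a ha => (congrFun hτ ⟨a, ha⟩).symm⟩

theorem InfRigidOn.finrank_le {adj : α → α → Prop} {A : Finset α} {p : α → E d}
    (h : InfRigidOn adj A p) :
    Module.finrank ℝ (motions (bonds (fun x y : A => adj x y) fun x : A => p x)) ≤
      Module.finrank ℝ (trivialMotions d) :=
  (Submodule.finrank_mono (infRigidOn_iff.1 h)).trans (LinearMap.finrank_range_le _)

theorem GenOn.trivialVelocities_injective [DecidableEq α] {A B : Finset α} {p p' : α → E d}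
    (h : GenOn p' B) (hd : 0 < d) (hB : d ≤ B.card) (hBA : B ⊆ A) (hp : ∀ b ∈ B, p b = p' b) :
    Function.Injective (trivialVelocities fun x : A => p x) := by
  rw [← LinearMap.ker_eq_bot, LinearMap.ker_eq_bot']
  intro τ hτ
  refine Subtype.ext (h.trivialMotion_eq_zero hd hB τ.2 fun a ha => ?_)
  have := congrFun hτ ⟨a, hBA ha⟩
  rw [← hp a ha]
  exact this

theorem infRigidOn_of_finrank_le {adj : α → α → Prop} {A : Finset α} {p : α → E d}
    (hinj : Function.Injective (trivialVelocities fun x : A => p x))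
    (h : Module.finrank ℝ (motions (bonds (fun x y : A => adj x y) fun x : A => p x)) ≤
      Module.finrank ℝ (trivialMotions d)) : InfRigidOn adj A p := by
  rw [infRigidOn_iff]
  refine (Submodule.eq_of_le_of_finrank_le (range_trivialVelocities_le _ _) ?_).ge
  rwa [LinearMap.finrank_range_of_inj hinj]

/-- The space of motions is smallest at generic points, where it still contains a full copy of the
trivial motions. -/
theorem InfRigidOn.of_special [DecidableEq α] {adj : α → α → Prop} {A : Finset α} {p b : α → E d}
    (h : InfRigidOn adj A p) (hb : GenOn b A) (hd : 0 < d) (hA : d ≤ A.card) :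
    InfRigidOn adj A b :=
  infRigidOn_of_finrank_le (hb.trivialVelocities_injective hd hA subset_rfl fun _ _ => rfl)
    ((finrank_motions_le (fun x y : A => adj x y) (fun x : A => p x) (fun x : A => b x) hb).trans h.finrank_le)

/-- Whiteley's vertex splitting. -/
theorem InfRigidOn.vertex_split [DecidableEq α] {adj adj' : α → α → Prop} {A C : Finset α}
    {p : α → E d} {x₀ y₀ : α} (hp : GenOn p A) (hx : x₀ ∈ A) (hy : y₀ ∈ A) (hxy : x₀ ≠ y₀)
    (hadj : adj x₀ y₀) (hCA : C ⊆ A) (hC : C.card + 1 = d) (hxC : x₀ ∉ C) (hyC : y₀ ∉ C)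
    (hCx : ∀ c ∈ C, adj x₀ c) (hCy : ∀ c ∈ C, adj y₀ c)
    (hadj' : ∀ a ∈ A.erase y₀, ∀ b ∈ A.erase y₀, adj' a b →
      adj a b ∨ (a = x₀ ∧ adj y₀ b) ∨ (b = x₀ ∧ adj y₀ a))
    (h : InfRigidOn adj' (A.erase y₀) p) : InfRigidOn adj A p := by
  classical
  have hd : 0 < d := by omega
  -- In `P t` the point of `y₀` slides along `e` into that of `x₀`. The system `ε t` keeps the bond
  -- of `x₀y₀` along `e` even at `t = 0`, where the edge collapses; for `t ≠ 0` this merely rescales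
  -- the true bond.
  let e : E d := p y₀ - p x₀
  let P : ℝ → α → E d := fun t z => if z = y₀ then p x₀ + t • e else p z
  have hPy : ∀ t, P t y₀ = p x₀ + t • e := fun t => if_pos rfl
  have hP : ∀ t z, z ≠ y₀ → P t z = p z := fun t z hz => if_neg hz
  let ε : ℝ → A → A → E d := fun t x y =>
    if ((x : α) = x₀ ∧ (y : α) = y₀) ∨ ((x : α) = y₀ ∧ (y : α) = x₀) then e
    else if adj x y then P t x - P t y else 0
  have hcont : Continuous fun t => bondMatrix (ε t) := by
    have hPc : ∀ z i, Continuous fun t => P t z i := by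
      intro z i
      by_cases hz : z = y₀
      · simp only [P, hz, if_true]; simp; fun_prop
      · simp only [P, hz, if_false]; fun_prop
    have hε : ∀ x y i, Continuous fun t => ε t x y i := by
      intro x y i
      simp only [ε]
      split_ifs
      · fun_prop
      · exact (hPc x i).sub (hPc y i)
      · fun_prop
    refine continuous_matrix fun a c => ?_
    simp only [bondMatrix, Matrix.of_apply]
    refine Continuous.sub ?_ ?_ <;> split_ifs
    exacts [hε _ _ _, continuous_const, hε _ _ _, continuous_const]
  -- a motion of the degenerate system is trivial
  have h0 : Module.finrank ℝ (motions (ε 0)) ≤ Module.finrank ℝ (trivialMotions d) := by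
    have hle : motions (ε 0) ≤ LinearMap.range (trivialVelocities fun x : A => P 0 x) := by
      intro q hq
      rw [mem_motions] at hq
      have hedge : ∀ x y : A, adj x y → ¬ (((x : α) = x₀ ∧ (y : α) = y₀) ∨
          ((x : α) = y₀ ∧ (y : α) = x₀)) → inner ℝ (P 0 x - P 0 y) (q x - q y) = 0 := by
        intro x y hxy' hn
        have := hq x y
        simpa only [ε, if_neg hn, if_pos hxy'] using this
      have hP0 : P 0 y₀ = p x₀ := by rw [hPy]; simp
      -- The `d - 1` common neighbours in `C` and the direction `e` give `d` independent
      -- orthogonality conditions. Once the two velocities agree, `q` is a motion of the contracted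
      -- framework.
      have hz : q ⟨x₀, hx⟩ - q ⟨y₀, hy⟩ = 0 := by
        have hcard : (insert x₀ (insert y₀ C)).card = d + 1 := by
          rw [Finset.card_insert_of_notMem (by simp [hxy, hxC]),
            Finset.card_insert_of_notMem hyC, hC]
        refine (hp.mono (B := insert x₀ (insert y₀ C)) ?_).eq_zero_of_inner hcard
          (Finset.mem_insert_self x₀ _) ?_
        · intro z hz
          simp only [Finset.mem_insert] at hz
          rcases hz with rfl | rfl | hz
          exacts [hx, hy, hCA hz]
        · intro c hc
          simp only [Finset.mem_insert] at hc
          rcases hc with rfl | rfl | hc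
          · simp
          · have := hq ⟨x₀, hx⟩ ⟨c, hy⟩
            simpa [ε, e] using this
          · have hcx : c ≠ x₀ := fun h => hxC (h ▸ hc)
            have hcy : c ≠ y₀ := fun h => hyC (h ▸ hc)
            have h1 := hedge ⟨x₀, hx⟩ ⟨c, hCA hc⟩ (hCx c hc) (by simp [hcy, hxy])
            have h2 := hedge ⟨y₀, hy⟩ ⟨c, hCA hc⟩ (hCy c hc) (by simp [hcx, hxy.symm])
            simp only [hP 0 x₀ hxy, hP 0 c hcy, hP0] at h1 h2
            have e1 : q ⟨x₀, hx⟩ - q ⟨y₀, hy⟩ =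
              (q ⟨x₀, hx⟩ - q ⟨c, hCA hc⟩) - (q ⟨y₀, hy⟩ - q ⟨c, hCA hc⟩) := by abel
            rw [e1, inner_sub_right, ← neg_sub (p x₀) (p c), inner_neg_left, inner_neg_left,
              h1, h2]
            simp
      have hqxy : q ⟨x₀, hx⟩ = q ⟨y₀, hy⟩ := sub_eq_zero.1 hz
      obtain ⟨τ, hτ, hqτ⟩ := h (fun a => if h : a ∈ A then q ⟨a, h⟩ else 0) (by
        intro a ha b hb hab
        have haA := Finset.mem_of_mem_erase ha
        have hbA := Finset.mem_of_mem_erase hb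
        have hay := Finset.ne_of_mem_erase ha
        have hby := Finset.ne_of_mem_erase hb
        simp only [haA, hbA, dif_pos]
        rcases hadj' a ha b hb hab with h1 | ⟨rfl, h1⟩ | ⟨rfl, h1⟩
        · have := hedge ⟨a, haA⟩ ⟨b, hbA⟩ h1 (by simp [hay, hby])
          simpa only [hP 0 a hay, hP 0 b hby] using this
        · by_cases hba : b = a
          · simp [hba]
          · have := hedge ⟨y₀, hy⟩ ⟨b, hbA⟩ h1 (by simp [hby, hba])
            simpa only [hP0, hP 0 b hby, ← hqxy] using this
        · by_cases hab' : a = b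
          · simp [hab']
          · have := hedge ⟨y₀, hy⟩ ⟨a, haA⟩ h1 (by simp [hay, hab'])
            simp only [hP0, hP 0 a hay, ← hqxy] at this
            rw [← neg_sub (p b), ← neg_sub (q ⟨b, hx⟩), inner_neg_neg]
            exact this)
      refine ⟨⟨τ, hτ⟩, ?_⟩
      funext a
      by_cases hay : (a : α) = y₀
      · have h1 := hqτ x₀ (Finset.mem_erase.2 ⟨hxy, hx⟩)
        obtain ⟨a, ha⟩ := a
        subst hay
        simp only [hx, dif_pos] at h1
        simp only [trivialVelocities, LinearMap.coe_mk, AddHom.coe_mk, hP0]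
        rw [← h1, hqxy]
      · have h1 := hqτ a (Finset.mem_erase.2 ⟨hay, a.2⟩)
        simp only [a.2, dif_pos] at h1
        simp only [trivialVelocities, LinearMap.coe_mk, AddHom.coe_mk, hP 0 _ hay]
        exact h1.symm
    exact (Submodule.finrank_mono hle).trans (LinearMap.finrank_range_le _)
  -- Rank is lower semicontinuous, so some `t ≠ 0` has at least the rank of the degenerate system.
  obtain ⟨t, ht, ht0⟩ := (((eventually_rank_le _ hcont 0).filter_mono
    (nhdsWithin_le_nhds (s := {0}ᶜ))).and self_mem_nhdsWithin).exists
  have hinc : insert x₀ C ⊆ A.erase y₀ := by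
    intro z hz
    rw [Finset.mem_insert] at hz
    rcases hz with rfl | hz
    · exact Finset.mem_erase.2 ⟨hxy, hx⟩
    · exact Finset.mem_erase.2 ⟨fun h => hyC (h ▸ hz), hCA hz⟩
  have hcard : d ≤ (A.erase y₀).card := by
    rw [← hC, ← Finset.card_insert_of_notMem hxC]
    exact Finset.card_le_card hinc
  refine InfRigidOn.of_special (p := P t) ?_ hp hd
    (hcard.trans (Finset.card_le_card (Finset.erase_subset _ _)))
  refine infRigidOn_of_finrank_le ((hp.mono (Finset.erase_subset y₀ A)).trivialVelocities_injective
    hd hcard (Finset.erase_subset _ _) fun b hb => hP t b (Finset.ne_of_mem_erase hb)) ?_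
  have hle : motions (bonds (fun x y : A => adj x y) fun x : A => P t x) ≤ motions (ε t) := by
    intro q hq
    rw [mem_motions_bonds] at hq
    have hxy0 : inner ℝ e (q ⟨x₀, hx⟩ - q ⟨y₀, hy⟩) = 0 := by
      have := hq ⟨x₀, hx⟩ ⟨y₀, hy⟩ hadj
      simp only [hP t x₀ hxy, hPy] at this
      rw [sub_add_cancel_left, inner_neg_left, inner_smul_left, neg_eq_zero] at this
      exact (mul_eq_zero.1 this).resolve_left (by simpa using ht0)
    rw [mem_motions]
    rintro ⟨x, hxA⟩ ⟨y, hyA⟩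
    simp only [ε]
    split_ifs with h1 h2
    · rcases h1 with ⟨rfl, rfl⟩ | ⟨rfl, rfl⟩
      · exact hxy0
      · rw [← neg_sub, inner_neg_right, hxy0, neg_zero]
    · exact hq _ _ h2
    · simp
  have h1 := finrank_motions_add_rank (ε t)
  have h2 := finrank_motions_add_rank (ε 0)
  have h3 := Submodule.finrank_mono hle
  omega

end Rigid

/-! ### Chains modulo two -/

section Chains

variable {α : Type*} [DecidableEq α]

/-- The coefficient at `F` of the boundary of `C`, modulo two. -/
def bd (C : Finset (Finset α)) (F : Finset α) : ZMod 2 := ∑ U ∈ C, if F ⊆ U then 1 else 0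

def IsCyc (k : ℕ) (C : Finset (Finset α)) : Prop :=
  (∀ U ∈ C, U.card = k + 1) ∧ ∀ F, F.card = k → bd C F = 0

def IsCirc (k : ℕ) (C : Finset (Finset α)) : Prop :=
  C.Nonempty ∧ IsCyc k C ∧ ∀ D ⊆ C, D.Nonempty → IsCyc k D → D = C

def verts (C : Finset (Finset α)) : Finset α := C.biUnion id

theorem mem_verts {C : Finset (Finset α)} {a : α} : a ∈ verts C ↔ ∃ U ∈ C, a ∈ U := by
  simp [verts]

theorem subset_verts {C : Finset (Finset α)} {U : Finset α} (hU : U ∈ C) : U ⊆ verts C :=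
  fun _ ha => mem_verts.2 ⟨U, hU, ha⟩

theorem bd_eq_card (C : Finset (Finset α)) (F : Finset α) :
    bd C F = ((C.filter (F ⊆ ·)).card : ZMod 2) := by
  rw [bd, Finset.sum_boole]

theorem exists_of_bd_ne_zero {C : Finset (Finset α)} {F : Finset α} (h : bd C F ≠ 0) :
    ∃ U ∈ C, F ⊆ U := by
  by_contra hn
  push Not at hn
  exact h (Finset.sum_eq_zero fun U hU => if_neg (hn U hU))

theorem bd_eq_zero_of_forall {C : Finset (Finset α)} {F : Finset α} (h : ∀ U ∈ C, ¬ F ⊆ U) :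
    bd C F = 0 :=
  Finset.sum_eq_zero fun U hU => if_neg (h U hU)

theorem bd_sdiff {C D : Finset (Finset α)} (h : D ⊆ C) (F : Finset α) :
    bd (C \ D) F = bd C F - bd D F := by
  rw [eq_sub_iff_add_eq]; exact Finset.sum_sdiff h

theorem bd_filter_add (C : Finset (Finset α)) (P : Finset α → Prop) [DecidablePred P]
    (F : Finset α) : bd (C.filter P) F + bd (C.filter fun U => ¬ P U) F = bd C F :=
  Finset.sum_filter_add_sum_filter_not _ _ _

theorem bd_biUnion {𝓟 : Finset (Finset (Finset α))}
    (h : (𝓟 : Set (Finset (Finset α))).PairwiseDisjoint id) (F : Finset α) :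
    bd (𝓟.biUnion id) F = ∑ T ∈ 𝓟, bd T F :=
  Finset.sum_biUnion h

theorem bd_symmDiff (C D : Finset (Finset α)) (F : Finset α) :
    bd (symmDiff C D) F = bd C F + bd D F := by
  have h1 : bd (symmDiff C D) F = bd (C \ D) F + bd (D \ C) F :=
    Finset.sum_union disjoint_sdiff_sdiff
  have h2 : bd C F = bd (C \ D) F + bd (C ∩ D) F := by
    rw [add_comm]; exact (Finset.sum_inter_add_sum_sdiff C D _).symm
  have h3 : bd D F = bd (D \ C) F + bd (C ∩ D) F := by
    rw [add_comm, Finset.inter_comm]; exact (Finset.sum_inter_add_sum_sdiff D C _).symm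
  rw [h1, h2, h3]
  have := CharTwo.add_self_eq_zero (bd (C ∩ D) F)
  linear_combination -this

theorem IsCyc.sdiff {k : ℕ} {C D : Finset (Finset α)} (hC : IsCyc k C) (hD : IsCyc k D)
    (h : D ⊆ C) : IsCyc k (C \ D) :=
  ⟨fun U hU => hC.1 U (Finset.mem_sdiff.1 hU).1, fun F hF => by
    rw [bd_sdiff h, hC.2 F hF, hD.2 F hF, sub_zero]⟩

theorem IsCyc.symmDiff {k : ℕ} {C D : Finset (Finset α)} (hC : IsCyc k C) (hD : IsCyc k D) :
    IsCyc k (symmDiff C D) := by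
  refine ⟨fun U hU => ?_, fun F hF => by rw [bd_symmDiff, hC.2 F hF, hD.2 F hF, add_zero]⟩
  rcases Finset.mem_symmDiff.1 hU with h | h
  exacts [hC.1 U h.1, hD.1 U h.1]

theorem IsCyc.exists_ne {k : ℕ} {C : Finset (Finset α)} (hC : IsCyc k C) {U F : Finset α}
    (hU : U ∈ C) (hF : F.card = k) (hFU : F ⊆ U) : ∃ U' ∈ C, U' ≠ U ∧ F ⊆ U' := by
  by_contra hn
  push Not at hn
  have h := hC.2 F hF
  rw [bd, Finset.sum_eq_single_of_mem U hU fun V hV hVU => if_neg (hn V hV hVU), if_pos hFU] at h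
  exact one_ne_zero h

/-- The boundary of a boundary is zero: a simplex containing `G` has exactly two vertices outside
`G`. -/
theorem sum_bd_insert {m : ℕ} {C : Finset (Finset α)} {G W : Finset α}
    (hC : ∀ U ∈ C, U.card = m) (hG : G.card + 2 = m) (hW : verts C ⊆ W) :
    ∑ z ∈ W \ G, bd C (insert z G) = 0 := by
  unfold bd
  rw [Finset.sum_comm]
  refine Finset.sum_eq_zero fun U hU => ?_
  by_cases hGU : G ⊆ U
  · have : (W \ G).filter (fun z => insert z G ⊆ U) = U \ G := by
      ext z
      simp only [Finset.mem_filter, Finset.mem_sdiff, Finset.insert_subset_iff]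
      exact ⟨fun h => ⟨h.2.1, h.1.2⟩, fun h => ⟨⟨hW (subset_verts hU h.1), h.2⟩, h.1, hGU⟩⟩
    rw [Finset.sum_boole, this, Finset.card_sdiff_of_subset hGU, hC U hU, ← hG,
      Nat.add_sub_cancel_left]
    rfl
  · exact Finset.sum_eq_zero fun z _ =>
      if_neg fun h => hGU ((Finset.subset_insert _ _).trans h)

/-- A boundary face is never the only one around a ridge `G`. This later rules out boundaries
concentrated on too few faces. -/
theorem exists_bd_insert_ne_zero {m : ℕ} {C : Finset (Finset α)} {G : Finset α}
    (hC : ∀ U ∈ C, U.card = m) (hG : G.card + 2 = m) {z₀ : α} (hz₀ : z₀ ∉ G)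
    (h : bd C (insert z₀ G) ≠ 0) : ∃ z, z ∉ G ∧ z ≠ z₀ ∧ bd C (insert z G) ≠ 0 := by
  by_contra hn
  push Not at hn
  have h1 := sum_bd_insert hC hG (W := insert z₀ (verts C)) (Finset.subset_insert _ _)
  rw [Finset.sum_eq_single_of_mem z₀ (by simp [hz₀])
    fun z hz hne => hn z (Finset.mem_sdiff.1 hz).2 hne] at h1
  exact h h1

/-- Split off a nonempty member of least size and recurse on the rest. The property is left abstract
because the statement serves both for cycles and for relative cycles. -/
theorem exists_partition_minimal {β : Type*} [DecidableEq β] (P : Finset β → Prop)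
    (hP : ∀ X Y, P X → P Y → Y ⊆ X → P (X \ Y)) (X : Finset β) (hX : P X) :
    ∃ 𝓟 : Finset (Finset β),
      (∀ Y ∈ 𝓟, Y.Nonempty ∧ P Y ∧ ∀ Z ⊆ Y, Z.Nonempty → P Z → Z = Y) ∧
      (𝓟 : Set (Finset β)).PairwiseDisjoint id ∧ 𝓟.biUnion id = X := by
  classical
  induction X using Finset.strongInduction with
  | H X ih =>
    by_cases h0 : X = ∅
    · exact ⟨∅, by simp, by simp, by simp [h0]⟩
    · have hne : (X.powerset.filter fun Y => Y.Nonempty ∧ P Y).Nonempty :=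
        ⟨X, by simp [hX, Finset.nonempty_iff_ne_empty, h0]⟩
      obtain ⟨Y, hY, hmin⟩ := Finset.exists_min_image _ Finset.card hne
      simp only [Finset.mem_filter, Finset.mem_powerset] at hY hmin
      obtain ⟨hYX, hYne, hPY⟩ := hY
      obtain ⟨𝓟, h1, h2, h3⟩ := ih (X \ Y) (Finset.sdiff_ssubset hYX hYne) (hP _ _ hX hPY hYX)
      have hdisj : ∀ Z ∈ 𝓟, Disjoint Y Z := by
        intro Z hZ
        have : Z ⊆ X \ Y := by
          rw [← h3]; exact Finset.subset_biUnion_of_mem id hZ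
        exact (Finset.disjoint_of_subset_left this Finset.sdiff_disjoint).symm
      refine ⟨insert Y 𝓟, ?_, ?_, ?_⟩
      · intro Z hZ
        rcases Finset.mem_insert.1 hZ with rfl | hZ
        · refine ⟨hYne, hPY, fun W hW hWne hPW => Finset.eq_of_subset_of_card_le hW ?_⟩
          exact hmin W ⟨hW.trans hYX, hWne, hPW⟩
        · exact h1 Z hZ
      · rw [Finset.coe_insert]
        exact h2.insert fun Z hZ _ => hdisj Z hZ
      · rw [Finset.biUnion_insert, h3, id, Finset.union_sdiff_of_subset hYX]

theorem IsCyc.exists_circ_partition {k : ℕ} {C : Finset (Finset α)} (hC : IsCyc k C) :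
    ∃ 𝓟 : Finset (Finset (Finset α)), (∀ T ∈ 𝓟, IsCirc k T) ∧
      (𝓟 : Set (Finset (Finset α))).PairwiseDisjoint id ∧ 𝓟.biUnion id = C :=
  exists_partition_minimal (IsCyc k) (fun _ _ h1 h2 h3 => h1.sdiff h2 h3) C hC

end Chains

/-! ### Cycles relative to the contraction of an edge -/

section Relative

variable {α : Type*} [DecidableEq α] {k : ℕ} {x y : α}

/-- Chains, avoiding simplices through both `x` and `y`, whose image under the contraction of `y`
onto `x` is a cycle. -/
structure IsRelCyc (k : ℕ) (x y : α) (T : Finset (Finset α)) : Prop where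
  card_eq : ∀ U ∈ T, U.card = k + 1
  notMem : ∀ U ∈ T, x ∈ U → y ∉ U
  bd_eq_zero : ∀ F, F.card = k → x ∉ F → y ∉ F → bd T F = 0
  bd_eq_bd : ∀ B, B.card + 1 = k → x ∉ B → y ∉ B → bd T (insert x B) = bd T (insert y B)

theorem IsRelCyc.sdiff {T D : Finset (Finset α)} (hT : IsRelCyc k x y T) (hD : IsRelCyc k x y D)
    (h : D ⊆ T) : IsRelCyc k x y (T \ D) where
  card_eq U hU := hT.card_eq U (Finset.mem_sdiff.1 hU).1
  notMem U hU := hT.notMem U (Finset.mem_sdiff.1 hU).1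
  bd_eq_zero F h1 h2 h3 := by
    rw [bd_sdiff h, hT.bd_eq_zero F h1 h2 h3, hD.bd_eq_zero F h1 h2 h3, sub_zero]
  bd_eq_bd B h1 h2 h3 := by
    rw [bd_sdiff h, bd_sdiff h, hT.bd_eq_bd B h1 h2 h3, hD.bd_eq_bd B h1 h2 h3]

theorem not_subset_of_both_mem (hxy : x ≠ y) {U F : Finset α} (hU : U.card = k + 1)
    (hF : F.card = k) (hx : x ∈ U) (hy : y ∈ U) (hxF : x ∉ F) (hyF : y ∉ F) : ¬ F ⊆ U := by
  intro h
  have h1 : insert x (insert y F) ⊆ U := by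
    rw [Finset.insert_subset_iff, Finset.insert_subset_iff]; exact ⟨hx, hy, h⟩
  have h2 := Finset.card_le_card h1
  rw [Finset.card_insert_of_notMem (by simp [hxy, hxF]), Finset.card_insert_of_notMem hyF] at h2
  omega

theorem IsCyc.isRelCyc_filter (hxy : x ≠ y) {C : Finset (Finset α)} (hC : IsCyc k C) :
    IsRelCyc k x y (C.filter fun U => ¬ (x ∈ U ∧ y ∈ U)) where
  card_eq U hU := hC.1 U (Finset.mem_filter.1 hU).1
  notMem U hU hx hy := (Finset.mem_filter.1 hU).2 ⟨hx, hy⟩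
  bd_eq_zero F h1 h2 h3 := by
    have := bd_filter_add C (fun U => x ∈ U ∧ y ∈ U) F
    rw [hC.2 F h1, bd_eq_zero_of_forall, zero_add] at this
    · exact this
    · intro U hU
      rw [Finset.mem_filter] at hU
      exact not_subset_of_both_mem hxy (hC.1 U hU.1) h1 hU.2.1 hU.2.2 h2 h3
  bd_eq_bd B h1 h2 h3 := by
    have hx := bd_filter_add C (fun U => x ∈ U ∧ y ∈ U) (insert x B)
    have hy := bd_filter_add C (fun U => x ∈ U ∧ y ∈ U) (insert y B)
    rw [hC.2 _ (by rw [Finset.card_insert_of_notMem h2, h1])] at hx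
    rw [hC.2 _ (by rw [Finset.card_insert_of_notMem h3, h1])] at hy
    have : bd (C.filter fun U => x ∈ U ∧ y ∈ U) (insert x B) =
        bd (C.filter fun U => x ∈ U ∧ y ∈ U) (insert y B) := by
      refine Finset.sum_congr rfl fun U hU => ?_
      rw [Finset.mem_filter] at hU
      simp [Finset.insert_subset_iff, hU.2.1, hU.2.2]
    rw [this] at hx
    exact add_left_cancel (hx.trans hy.symm)

/-- The contraction of `y` onto `x`. -/
def contractSet (x y : α) (U : Finset α) : Finset α := if y ∈ U then insert x (U.erase y) else U

theorem notMem_contractSet (hxy : x ≠ y) (U : Finset α) : y ∉ contractSet x y U := by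
  unfold contractSet
  split_ifs with h
  · simp [hxy.symm]
  · exact h

theorem card_contractSet {U : Finset α} (h : x ∈ U → y ∉ U) :
    (contractSet x y U).card = U.card := by
  unfold contractSet
  split_ifs with hy
  · have hx : x ∉ U := fun hx => h hx hy
    rw [Finset.card_insert_of_notMem (by simp [hx]), Finset.card_erase_add_one hy]
  · rfl

theorem subset_contractSet_iff {U F : Finset α} (hx : x ∉ F) (hy : y ∉ F) :
    F ⊆ contractSet x y U ↔ F ⊆ U := by
  unfold contractSet
  split_ifs with h
  · rw [Finset.subset_insert_iff_of_notMem hx, Finset.subset_erase]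
    exact ⟨fun h => h.1, fun h => ⟨h, hy⟩⟩
  · rfl

theorem ite_insert_subset_contractSet {U B : Finset α} (h : x ∈ U → y ∉ U)
    (hx : x ∉ B) (hy : y ∉ B) :
    (if insert x B ⊆ contractSet x y U then (1 : ZMod 2) else 0) =
      (if insert x B ⊆ U then 1 else 0) + if insert y B ⊆ U then 1 else 0 := by
  simp only [Finset.insert_subset_iff, subset_contractSet_iff hx hy]
  by_cases hyU : y ∈ U
  · have hxU : x ∉ U := fun hx => h hx hyU
    simp [contractSet, hyU, hxU]
  · simp [contractSet, hyU]

theorem bd_image_contractSet {T : Finset (Finset α)} (hinj : Set.InjOn (contractSet x y) T)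
    (F : Finset α) :
    bd (T.image (contractSet x y)) F = ∑ U ∈ T, if F ⊆ contractSet x y U then 1 else 0 :=
  Finset.sum_image hinj

/-- The faces `x ∪ B` and `y ∪ B` are merged by the contraction and their coefficients add, so
modulo two the sum vanishes exactly when they are equal. Injectivity is needed because the image, as
a set, would count two simplices with a common image only once. -/
theorem isCyc_image_contractSet_iff (hxy : x ≠ y) {T : Finset (Finset α)}
    (hinj : Set.InjOn (contractSet x y) T) (hT : ∀ U ∈ T, x ∈ U → y ∉ U) :
    IsCyc k (T.image (contractSet x y)) ↔ IsRelCyc k x y T := by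
  have h1 : ∀ F : Finset α, x ∉ F → y ∉ F → bd (T.image (contractSet x y)) F = bd T F := by
    intro F hx hy
    rw [bd_image_contractSet hinj]
    exact Finset.sum_congr rfl fun U _ => by simp only [subset_contractSet_iff hx hy]
  have h2 : ∀ B : Finset α, x ∉ B → y ∉ B →
      bd (T.image (contractSet x y)) (insert x B) = bd T (insert x B) + bd T (insert y B) := by
    intro B hx hy
    rw [bd_image_contractSet hinj, bd, bd, ← Finset.sum_add_distrib]
    exact Finset.sum_congr rfl fun U hU => ite_insert_subset_contractSet (hT U hU) hx hy
  constructor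
  · intro h
    refine ⟨fun U hU => ?_, hT, fun F hF hx hy => ?_, fun B hB hx hy => ?_⟩
    · rw [← card_contractSet (hT U hU)]
      exact h.1 _ (Finset.mem_image_of_mem _ hU)
    · rw [← h1 F hx hy, h.2 F hF]
    · have := h.2 (insert x B) (by rw [Finset.card_insert_of_notMem hx, hB])
      rw [h2 B hx hy] at this
      exact CharTwo.add_eq_zero.1 this
  · intro h
    refine ⟨fun U hU => ?_, fun F hF => ?_⟩
    · obtain ⟨V, hV, rfl⟩ := Finset.mem_image.1 hU
      rw [card_contractSet (hT V hV), h.card_eq V hV]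
    · by_cases hy : y ∈ F
      · refine bd_eq_zero_of_forall fun U hU hFU => ?_
        obtain ⟨U, -, rfl⟩ := Finset.mem_image.1 hU
        exact notMem_contractSet hxy U (hFU hy)
      · by_cases hx : x ∈ F
        · have hc := Finset.card_erase_add_one hx
          have := h2 (F.erase x) (Finset.notMem_erase _ _) (fun h => hy (Finset.mem_of_mem_erase h))
          rw [Finset.insert_erase hx] at this
          rw [this, CharTwo.add_eq_zero]
          have h3 := h.bd_eq_bd (F.erase x) (by omega) (Finset.notMem_erase _ _)
            (fun h => hy (Finset.mem_of_mem_erase h))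
          rwa [Finset.insert_erase hx] at h3
        · rw [h1 F hx hy, h.bd_eq_zero F hF hx hy]

theorem isRelCyc_pair (hxy : x ≠ y) {A : Finset α} (hx : x ∉ A) (hy : y ∉ A) (hA : A.card = k) :
    IsRelCyc k x y {insert x A, insert y A} := by
  have hne : insert x A ≠ insert y A := by
    intro h
    have : x ∈ insert y A := h ▸ Finset.mem_insert_self x A
    simp [hxy, hx] at this
  have hbd : ∀ F, bd {insert x A, insert y A} F =
      (if F ⊆ insert x A then 1 else 0) + if F ⊆ insert y A then 1 else 0 := fun F =>
    Finset.sum_pair hne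
  refine ⟨fun U hU => ?_, fun U hU => ?_, fun F hF hxF hyF => ?_, fun B hB hxB hyB => ?_⟩
  · simp only [Finset.mem_insert, Finset.mem_singleton] at hU
    rcases hU with rfl | rfl
    · rw [Finset.card_insert_of_notMem hx, hA]
    · rw [Finset.card_insert_of_notMem hy, hA]
  · simp only [Finset.mem_insert, Finset.mem_singleton] at hU
    rcases hU with rfl | rfl
    · simp [hxy.symm, hy]
    · simp [hxy, hx]
  · simp only [hbd, Finset.subset_insert_iff_of_notMem hxF, Finset.subset_insert_iff_of_notMem hyF]
    exact CharTwo.add_self_eq_zero _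
  · rw [hbd, hbd]
    simp only [Finset.insert_subset_iff, Finset.mem_insert, hxy, hxy.symm, hx, hy, true_or,
      or_self, false_and, true_and, if_false, add_zero, zero_add,
      Finset.subset_insert_iff_of_notMem hxB, Finset.subset_insert_iff_of_notMem hyB]

/-- A minimal relative cycle is a pair of simplices with the same contraction or it contracts
bijectively to a circuit. -/
theorem IsRelCyc.pair_or_isCirc (hxy : x ≠ y) {T : Finset (Finset α)} (hT : IsRelCyc k x y T)
    (hne : T.Nonempty) (hmin : ∀ D ⊆ T, D.Nonempty → IsRelCyc k x y D → D = T) :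
    (∃ A, x ∉ A ∧ y ∉ A ∧ A.card = k ∧ T = {insert x A, insert y A}) ∨
      IsCirc k (T.image (contractSet x y)) := by
  by_cases hinj : Set.InjOn (contractSet x y) T
  · right
    refine ⟨hne.image _, (isCyc_image_contractSet_iff hxy hinj hT.notMem).2 hT,
      fun D hD hDne hDc => ?_⟩
    let D' := T.filter fun U => contractSet x y U ∈ D
    have hD' : D'.image (contractSet x y) = D := by
      ext U
      simp only [D', Finset.mem_image, Finset.mem_filter]
      constructor
      · rintro ⟨V, ⟨-, hV⟩, rfl⟩; exact hV
      · intro hU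
        obtain ⟨V, hV, rfl⟩ := Finset.mem_image.1 (hD hU)
        exact ⟨V, ⟨hV, hU⟩, rfl⟩
    have hD'T : D' ⊆ T := Finset.filter_subset _ _
    rw [← hD'] at hDc hDne ⊢
    rw [hmin D' hD'T (Finset.image_nonempty.1 hDne)
      ((isCyc_image_contractSet_iff hxy (hinj.mono hD'T) fun U hU => hT.notMem U (hD'T hU)).1 hDc)]
  · left
    -- Two simplices with the same contraction already form a relative cycle, so by minimality there
    -- are no others.
    have key : ∀ U ∈ T, ∀ U' ∈ T, contractSet x y U = contractSet x y U' → y ∈ U → y ∉ U' →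
        ∃ A, x ∉ A ∧ y ∉ A ∧ A.card = k ∧ T = {insert x A, insert y A} := by
      intro U hU U' hU' h hy hy'
      have hx : x ∉ U := fun hx => hT.notMem U hU hx hy
      have hxe : x ∉ U.erase y := fun h => hx (Finset.mem_of_mem_erase h)
      have hcard : (U.erase y).card = k := by
        rw [Finset.card_erase_of_mem hy, hT.card_eq U hU]; rfl
      simp only [contractSet, if_pos hy, if_neg hy'] at h
      refine ⟨U.erase y, hxe, Finset.notMem_erase _ _, hcard, (hmin _ ?_ (by simp)
        (isRelCyc_pair hxy hxe (Finset.notMem_erase _ _) hcard)).symm⟩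
      rw [Finset.insert_subset_iff, Finset.singleton_subset_iff, h, Finset.insert_erase hy]
      exact ⟨hU', hU⟩
    unfold Set.InjOn at hinj
    push Not at hinj
    obtain ⟨U, hU, U', hU', h, hUU⟩ := hinj
    rw [Finset.mem_coe] at hU hU'
    by_cases hy : y ∈ U <;> by_cases hy' : y ∈ U'
    · exfalso
      have hx : x ∉ U.erase y := fun hx => hT.notMem U hU (Finset.mem_of_mem_erase hx) hy
      have hx' : x ∉ U'.erase y := fun hx => hT.notMem U' hU' (Finset.mem_of_mem_erase hx) hy'
      simp only [contractSet, if_pos hy, if_pos hy'] at h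
      have := congrArg (fun s => insert y (Finset.erase s x)) h
      simp only [Finset.erase_insert hx, Finset.erase_insert hx', Finset.insert_erase hy,
        Finset.insert_erase hy'] at this
      exact hUU this
    · exact key U hU U' hU' h hy hy'
    · exact key U' hU' U hU h.symm hy' hy
    · simp only [contractSet, if_neg hy, if_neg hy'] at h
      exact absurd h hUU

end Relative

/-! ### Rigidity of cones over circuits -/

section Cone

variable {α : Type*} [DecidableEq α] {j : ℕ} {x y w : α}

/-- Adjacency in the cone with apex `w` over the complex `C`. -/
def coneAdj (C : Finset (Finset α)) (w a b : α) : Prop := (∃ U ∈ C, a ∈ U ∧ b ∈ U) ∨ a = w ∨ b = w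

/-- A relative cycle can have boundary only at faces containing exactly one of `x` and `y`, and
there the coefficients of `x ∪ B` and `y ∪ B` agree. -/
theorem IsRelCyc.exists_bd_ne_zero {T : Finset (Finset α)} (hT : IsRelCyc j x y T)
    (hcyc : ¬ IsCyc j T) :
    ∃ B : Finset α, B.card + 1 = j ∧ x ∉ B ∧ y ∉ B ∧ bd T (insert x B) ≠ 0 := by
  by_contra hn
  push Not at hn
  refine hcyc ⟨hT.card_eq, fun F hF => ?_⟩
  by_cases hx : x ∈ F <;> by_cases hy : y ∈ F
  · exact bd_eq_zero_of_forall fun U hU hFU => hT.notMem U hU (hFU hx) (hFU hy)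
  · have h := hn (F.erase x) (by rw [Finset.card_erase_add_one hx, hF])
      (Finset.notMem_erase _ _) (fun h => hy (Finset.mem_of_mem_erase h))
    rwa [Finset.insert_erase hx] at h
  · have hc : (F.erase y).card + 1 = j := by rw [Finset.card_erase_add_one hy, hF]
    have hx' : x ∉ F.erase y := fun h => hx (Finset.mem_of_mem_erase h)
    have h1 := hT.bd_eq_bd (F.erase y) hc hx' (Finset.notMem_erase _ _)
    rw [hn (F.erase y) hc hx' (Finset.notMem_erase _ _), Finset.insert_erase hy] at h1
    exact h1.symm
  · exact hT.bd_eq_zero F hF hx hy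

theorem verts_image_contractSet {T : Finset (Finset α)} (hxy : x ≠ y) (hx : x ∈ verts T) :
    verts (T.image (contractSet x y)) = (verts T).erase y := by
  ext a
  rw [Finset.mem_erase, mem_verts]
  constructor
  · rintro ⟨U, hU, ha⟩
    obtain ⟨V, hV, rfl⟩ := Finset.mem_image.1 hU
    refine ⟨fun h => notMem_contractSet hxy V (h ▸ ha), ?_⟩
    unfold contractSet at ha
    split_ifs at ha with hy
    · rcases Finset.mem_insert.1 ha with rfl | ha
      · exact hx
      · exact subset_verts hV (Finset.mem_of_mem_erase ha)
    · exact subset_verts hV ha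
  · rintro ⟨hay, ha⟩
    obtain ⟨U, hU, haU⟩ := mem_verts.1 ha
    refine ⟨_, Finset.mem_image_of_mem _ hU, ?_⟩
    unfold contractSet
    split_ifs with hy
    · exact Finset.mem_insert_of_mem (Finset.mem_erase.2 ⟨hay, haU⟩)
    · exact haU

theorem coneAdj_pair {A : Finset α} (hxy : x ≠ y) {a b : α}
    (ha : a ∈ insert w (insert x (insert y A))) (hb : b ∈ insert w (insert x (insert y A))) :
    coneAdj {insert x A, insert y A} w a b ∨ (a = x ∧ b = y) ∨ (a = y ∧ b = x) ∨ a = b := by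
  by_cases haw : a = w
  · exact Or.inl (Or.inr (Or.inl haw))
  by_cases hbw : b = w
  · exact Or.inl (Or.inr (Or.inr hbw))
  have ha' := (Finset.mem_insert.1 ha).resolve_left haw
  have hb' := (Finset.mem_insert.1 hb).resolve_left hbw
  by_cases h1 : a ≠ y ∧ b ≠ y
  · rw [Finset.insert_comm] at ha' hb'
    exact Or.inl (Or.inl ⟨insert x A, by simp, (Finset.mem_insert.1 ha').resolve_left h1.1,
      (Finset.mem_insert.1 hb').resolve_left h1.2⟩)
  by_cases h2 : a ≠ x ∧ b ≠ x
  · exact Or.inl (Or.inl ⟨insert y A, by simp, (Finset.mem_insert.1 ha').resolve_left h2.1,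
      (Finset.mem_insert.1 hb').resolve_left h2.2⟩)
  rw [not_and_or, not_not, not_not] at h1 h2
  right
  rcases h1 with rfl | rfl <;> rcases h2 with h | rfl
  · exact absurd h.symm hxy
  · exact Or.inr (Or.inl ⟨rfl, rfl⟩)
  · exact Or.inl ⟨h, rfl⟩
  · exact absurd rfl hxy

theorem verts_pair (A : Finset α) :
    verts ({insert x A, insert y A} : Finset (Finset α)) = insert x (insert y A) := by
  rw [verts, Finset.biUnion_insert, Finset.singleton_biUnion, id, id, Finset.insert_union,
    Finset.union_insert, Finset.union_self]

/-- With the edge `xy` added, the cone is a complete graph on `j + 3 = d + 1` generic points. -/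
theorem infRigidOn_pair (hxy : x ≠ y) {A : Finset α} (hxA : x ∉ A) (hyA : y ∉ A)
    (hA : A.card = j) (hw : w ∉ verts ({insert x A, insert y A} : Finset (Finset α)))
    {p : α → E (j + 2)}
    (hp : GenOn p (insert w (verts ({insert x A, insert y A} : Finset (Finset α))))) :
    InfRigidOn (fun a b => coneAdj {insert x A, insert y A} w a b ∨ (a = x ∧ b = y) ∨
      (a = y ∧ b = x)) (insert w (verts {insert x A, insert y A})) p := by
  rw [verts_pair] at hp hw ⊢
  intro q hq
  refine hp.isBody ?_ fun a ha b hb => ?_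
  · rw [Finset.card_insert_of_notMem hw, Finset.card_insert_of_notMem (by simp [hxy, hxA]),
      Finset.card_insert_of_notMem hyA, hA]
  · have hab := coneAdj_pair (A := A) hxy ha hb
    by_cases h : a = b
    · rw [h, sub_self, inner_zero_left]
    · refine hq a ha b hb ?_
      simpa only [h, or_false] using hab

/-- Contracting `y` onto `x` gives, apart from the pair case, a circuit on fewer vertices, whose
cone is rigid by `ih`. To undo the contraction by vertex splitting, `x` and `y` need `d - 1 = j + 1`
common neighbours. A boundary face `x ∪ B` and its twin `y ∪ B` supply the `j - 1` points of `B`, a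
neighbouring boundary face supplies one more point `z`, and the apex `w` is the last. -/
theorem IsRelCyc.infRigidOn (hj : 2 ≤ j) (hxy : x ≠ y) {T : Finset (Finset α)}
    (hT : IsRelCyc j x y T) (hne : T.Nonempty)
    (hmin : ∀ D ⊆ T, D.Nonempty → IsRelCyc j x y D → D = T) (hcyc : ¬ IsCyc j T)
    (hw : w ∉ verts T) {p : α → E (j + 2)} (hp : GenOn p (insert w (verts T)))
    (ih : ∀ D : Finset (Finset α), IsCirc j D → (verts D).card < (verts T).card → w ∉ verts D →
      GenOn p (insert w (verts D)) → InfRigidOn (coneAdj D w) (insert w (verts D)) p) :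
    x ∈ verts T ∧ y ∈ verts T ∧
      InfRigidOn (fun a b => coneAdj T w a b ∨ (a = x ∧ b = y) ∨ (a = y ∧ b = x))
        (insert w (verts T)) p := by
  obtain ⟨B, hB, hxB, hyB, hbd⟩ := hT.exists_bd_ne_zero hcyc
  obtain ⟨U₁, hU₁, hU₁B⟩ := exists_of_bd_ne_zero hbd
  obtain ⟨U₂, hU₂, hU₂B⟩ := exists_of_bd_ne_zero (hT.bd_eq_bd B hB hxB hyB ▸ hbd)
  rw [Finset.insert_subset_iff] at hU₁B hU₂B
  have hx : x ∈ verts T := subset_verts hU₁ hU₁B.1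
  have hy : y ∈ verts T := subset_verts hU₂ hU₂B.1
  refine ⟨hx, hy, ?_⟩
  rcases hT.pair_or_isCirc hxy hne hmin with ⟨A, hxA, hyA, hA, rfl⟩ | hcirc
  · exact infRigidOn_pair hxy hxA hyA hA hw hp
  · obtain ⟨b, hb⟩ : B.Nonempty := Finset.card_pos.1 (by omega)
    have hBb := Finset.card_erase_add_one hb
    have hxBb : x ∉ B.erase b := fun h => hxB (Finset.mem_of_mem_erase h)
    have hyBb : y ∉ B.erase b := fun h => hyB (Finset.mem_of_mem_erase h)
    have hbx : b ≠ x := fun h => hxB (h ▸ hb)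
    -- Turning about the ridge `x ∪ (B \ b)` gives a second boundary face, through `z`. Its twin
    -- under `IsRelCyc.bd_eq_bd` makes `z` a neighbour of `y` as well.
    obtain ⟨z, hzG, hzb, hz⟩ := exists_bd_insert_ne_zero (G := insert x (B.erase b)) (z₀ := b)
      hT.card_eq (by rw [Finset.card_insert_of_notMem hxBb]; omega) (by simp [hbx])
      (by rwa [Finset.insert_comm, Finset.insert_erase hb])
    rw [Finset.mem_insert, not_or] at hzG
    obtain ⟨hzx, hzBb⟩ := hzG
    have hzB : z ∉ B := fun h => hzBb (Finset.mem_erase.2 ⟨hzb, h⟩)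
    rw [Finset.insert_comm] at hz
    obtain ⟨U₃, hU₃, hU₃B⟩ := exists_of_bd_ne_zero hz
    simp only [Finset.insert_subset_iff] at hU₃B
    have hzy : z ≠ y := by
      rintro rfl
      exact hT.notMem U₃ hU₃ hU₃B.1 hU₃B.2.1
    obtain ⟨U₄, hU₄, hU₄B⟩ := exists_of_bd_ne_zero
      ((hT.bd_eq_bd (insert z (B.erase b)) (by rw [Finset.card_insert_of_notMem hzBb]; omega)
        (by simp [Ne.symm hzx, hxBb]) (by simp [hzy.symm, hyBb])) ▸ hz)
    simp only [Finset.insert_subset_iff] at hU₄B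
    have hwx : w ≠ x := fun h => hw (h ▸ hx)
    have hwy : w ≠ y := fun h => hw (h ▸ hy)
    have hwz : w ≠ z := fun h => hw (h ▸ subset_verts hU₃ hU₃B.2.1)
    have hwB : w ∉ B := fun h => hw (subset_verts hU₁ (hU₁B.2 h))
    have hverts : (insert w (verts T)).erase y = insert w (verts (T.image (contractSet x y))) := by
      rw [verts_image_contractSet hxy hx, Finset.erase_insert_of_ne hwy]
    refine InfRigidOn.vertex_split (adj' := coneAdj (T.image (contractSet x y)) w)
      (C := insert w (insert z B)) hp (Finset.mem_insert_of_mem hx) (Finset.mem_insert_of_mem hy)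
      hxy (Or.inr (Or.inl ⟨rfl, rfl⟩)) ?_ ?_ ?_ ?_ ?_ ?_ ?_ ?_
    · intro c hc
      simp only [Finset.mem_insert] at hc ⊢
      rcases hc with rfl | rfl | hc
      · exact Or.inl rfl
      · exact Or.inr (subset_verts hU₃ hU₃B.2.1)
      · exact Or.inr (subset_verts hU₁ (hU₁B.2 hc))
    · rw [Finset.card_insert_of_notMem (by simp [hwz, hwB]), Finset.card_insert_of_notMem hzB]
      omega
    · simp [hwx.symm, Ne.symm hzx, hxB]
    · simp [hwy.symm, hzy.symm, hyB]
    · intro c hc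
      simp only [Finset.mem_insert] at hc
      rcases hc with rfl | rfl | hc
      · exact Or.inl (Or.inr (Or.inr rfl))
      · exact Or.inl (Or.inl ⟨U₃, hU₃, hU₃B.1, hU₃B.2.1⟩)
      · exact Or.inl (Or.inl ⟨U₁, hU₁, hU₁B.1, hU₁B.2 hc⟩)
    · intro c hc
      simp only [Finset.mem_insert] at hc
      rcases hc with rfl | rfl | hc
      · exact Or.inl (Or.inr (Or.inr rfl))
      · exact Or.inl (Or.inl ⟨U₄, hU₄, hU₄B.1, hU₄B.2.1⟩)
      · exact Or.inl (Or.inl ⟨U₂, hU₂, hU₂B.1, hU₂B.2 hc⟩)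
    · intro a ha b hb hab
      rcases hab with ⟨U, hU, haU, hbU⟩ | rfl | rfl
      · obtain ⟨V, hV, rfl⟩ := Finset.mem_image.1 hU
        unfold contractSet at haU hbU
        split_ifs at haU hbU with hyV
        · simp only [Finset.mem_insert, Finset.mem_erase] at haU hbU
          rcases haU with rfl | haU <;> rcases hbU with rfl | hbU
          · exact Or.inr (Or.inl ⟨rfl, Or.inr (Or.inr ⟨rfl, rfl⟩)⟩)
          · exact Or.inr (Or.inl ⟨rfl, Or.inl (Or.inl ⟨V, hV, hyV, hbU.2⟩)⟩)
          · exact Or.inr (Or.inr ⟨rfl, Or.inl (Or.inl ⟨V, hV, hyV, haU.2⟩)⟩)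
          · exact Or.inl (Or.inl (Or.inl ⟨V, hV, haU.2, hbU.2⟩))
        · exact Or.inl (Or.inl (Or.inl ⟨V, hV, haU, hbU⟩))
      · exact Or.inl (Or.inl (Or.inr (Or.inl rfl)))
      · exact Or.inl (Or.inl (Or.inr (Or.inr rfl)))
    · rw [hverts]
      refine ih _ hcirc ?_ ?_ (hverts ▸ hp.mono (Finset.erase_subset _ _))
      · rw [verts_image_contractSet hxy hx]
        exact Finset.card_erase_lt_of_mem hy
      · rw [verts_image_contractSet hxy hx]
        exact fun h => hw (Finset.mem_of_mem_erase h)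

theorem bd_filter_both_mem {C : Finset (Finset α)} (hC : ∀ U ∈ C, U.card = j + 1)
    {B : Finset α} (hxy : x ≠ y) (hB : B.card + 1 = j) (hxB : x ∉ B) (hyB : y ∉ B)
    {U : Finset α} (hU : U ∈ C) (hx : x ∈ U) (hy : y ∈ U) (h : B ⊆ U) :
    U = insert x (insert y B) := by
  symm
  refine Finset.eq_of_subset_of_card_le (by simp [Finset.insert_subset_iff, hx, hy, h]) ?_
  rw [hC U hU, Finset.card_insert_of_notMem (by simp [hxy, hxB]), Finset.card_insert_of_notMem hyB,
    hB]

/-- The simplices of a cycle `C` that move with `τ` together with the apex form a cycle, provided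
the members of a partition into relative cycles are bodies. -/
theorem isCyc_filter_of_partition {C : Finset (Finset α)} (hC : IsCyc j C) (hxy : x ≠ y)
    (hw : w ∉ verts C) {p q : α → E (j + 2)} (hp : GenOn p (insert w (verts C)))
    {𝓟 : Finset (Finset (Finset α))} (h𝓟 : ∀ T ∈ 𝓟, IsRelCyc j x y T ∧ x ∈ verts T ∧ y ∈ verts T ∧
      IsBody p q (insert w (verts T)))
    (hdisj : (𝓟 : Set (Finset (Finset α))).PairwiseDisjoint id)
    (hunion : 𝓟.biUnion id = C.filter fun U => ¬ (x ∈ U ∧ y ∈ U))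
    {τ : (E (j + 2) →ₗ[ℝ] E (j + 2)) × E (j + 2)} (hτ : τ ∈ trivialMotions (j + 2))
    (P : Finset α → Prop) [DecidablePred P]
    (hP : ∀ U, P U ↔ ∀ a ∈ insert w U, q a = τ.1 (p a) + τ.2) :
    IsCyc j (C.filter P) := by
  classical
  -- a body containing a facet and the apex moves with `τ` when the facet does
  have huniq : ∀ T ∈ 𝓟, ∀ U ⊆ verts C, U.card = j + 1 → U ⊆ verts T → P U → P (verts T) := by
    intro T hT U hUC hUcard hUT hPU
    obtain ⟨σ, hσ, hσq⟩ := (h𝓟 T hT).2.2.2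
    have hsub : insert w U ⊆ insert w (verts T) := Finset.insert_subset_insert w hUT
    have : σ = τ := (hp.mono (Finset.insert_subset_insert w hUC)).trivialMotion_unique (by omega)
      (by rw [Finset.card_insert_of_notMem fun h => hw (hUC h), hUcard]) hσ hτ fun a ha => by
        rw [← hσq a (hsub ha), (hP U).1 hPU a ha]
    rw [hP]
    intro a ha
    rw [hσq a ha, this]
  have hmono : ∀ U V, U ⊆ V → P V → P U := by
    intro U V hUV hPV
    rw [hP] at hPV ⊢
    exact fun a ha => hPV a (Finset.insert_subset_insert w hUV ha)
  have hTC : ∀ T ∈ 𝓟, T ⊆ C := fun T hT =>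
    (Finset.subset_biUnion_of_mem id hT).trans (hunion ▸ Finset.filter_subset _ _)
  have hvTC : ∀ T ∈ 𝓟, verts T ⊆ verts C := fun T hT a ha => by
    obtain ⟨U, hU, haU⟩ := mem_verts.1 ha
    exact subset_verts (hTC T hT hU) haU
  have hE : (C.filter P).filter (fun U => ¬ (x ∈ U ∧ y ∈ U)) =
      (𝓟.filter fun T => P (verts T)).biUnion id := by
    ext U
    rw [Finset.filter_filter, Finset.mem_filter, Finset.mem_biUnion]
    constructor
    · rintro ⟨hU, hPU, hn⟩
      have : U ∈ 𝓟.biUnion id := by rw [hunion, Finset.mem_filter]; exact ⟨hU, hn⟩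
      obtain ⟨T, hT, hUT⟩ := Finset.mem_biUnion.1 this
      exact ⟨T, Finset.mem_filter.2 ⟨hT, huniq T hT U (subset_verts hU) (hC.1 U hU)
        (subset_verts hUT) hPU⟩, hUT⟩
    · rintro ⟨T, hT, hUT⟩
      rw [Finset.mem_filter] at hT
      have : U ∈ 𝓟.biUnion id := Finset.mem_biUnion.2 ⟨T, hT.1, hUT⟩
      rw [hunion, Finset.mem_filter] at this
      exact ⟨this.1, hmono U _ (subset_verts hUT) hT.2, this.2⟩
  have hsum : ∀ F, bd ((C.filter P).filter fun U => ¬ (x ∈ U ∧ y ∈ U)) F =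
      ∑ T ∈ 𝓟.filter (fun T => P (verts T)), bd T F := by
    intro F
    rw [hE]
    exact bd_biUnion (hdisj.subset fun T hT => (Finset.mem_filter.1 hT).1) F
  have hsplit := fun F => bd_filter_add (C.filter P) (fun U => x ∈ U ∧ y ∈ U) F
  have hcard : ∀ U ∈ C.filter P, U.card = j + 1 := fun U hU => hC.1 U (Finset.mem_filter.1 hU).1
  -- Every part `T` with boundary at `x ∪ B` contains `x`, `y` and `B`, and the only possible
  -- simplex through `xy` over this face is `{x, y} ∪ B`. Together with the apex these are `d`
  -- generic points, so either all of these pieces move with `τ`, and the coefficient is that of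
  -- `C`, or none does.
  have hxface : ∀ B : Finset α, B.card + 1 = j → x ∉ B → y ∉ B →
      bd (C.filter P) (insert x B) = 0 := by
    intro B hB hxB hyB
    have hU : ∀ U ∈ C, x ∈ U ∧ y ∈ U → insert x B ⊆ U → U = insert x (insert y B) :=
      fun U hU hxyU hBU => bd_filter_both_mem hC.1 hxy hB hxB hyB hU hxyU.1 hxyU.2
        ((Finset.subset_insert _ _).trans hBU)
    have hT : ∀ T ∈ 𝓟, bd T (insert x B) ≠ 0 → insert x (insert y B) ⊆ verts T := by
      intro T hT hne
      obtain ⟨U, hU, hUB⟩ := exists_of_bd_ne_zero hne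
      rw [Finset.insert_subset_iff] at hUB
      rw [Finset.insert_subset_iff, Finset.insert_subset_iff]
      exact ⟨(h𝓟 T hT).2.1, (h𝓟 T hT).2.2.1, hUB.2.trans (subset_verts hU)⟩
    have hc : (insert x (insert y B)).card = j + 1 := by
      rw [Finset.card_insert_of_notMem (by simp [hxy, hxB]), Finset.card_insert_of_notMem hyB, hB]
    rw [← hsplit, hsum]
    by_cases H : P (insert x (insert y B))
    · have h1 : ∑ T ∈ 𝓟.filter (fun T => P (verts T)), bd T (insert x B) =
          bd (C.filter fun U => ¬ (x ∈ U ∧ y ∈ U)) (insert x B) := by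
        rw [← hunion, bd_biUnion hdisj]
        refine Finset.sum_filter_of_ne fun T hT' hne => ?_
        exact huniq T hT' _ ((hT T hT' hne).trans (hvTC T hT')) hc (hT T hT' hne) H
      have h2 : bd ((C.filter P).filter fun U => x ∈ U ∧ y ∈ U) (insert x B) =
          bd (C.filter fun U => x ∈ U ∧ y ∈ U) (insert x B) := by
        rw [Finset.filter_comm]
        refine Finset.sum_filter_of_ne fun U hU' hne => ?_
        rw [Finset.mem_filter] at hU'
        rw [hU U hU'.1 hU'.2 (by by_contra h; exact hne (if_neg h))]
        exact H
      rw [h1, h2, bd_filter_add, hC.2 _ (by rw [Finset.card_insert_of_notMem hxB, hB])]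
    · rw [Finset.sum_eq_zero, bd_eq_zero_of_forall, add_zero]
      · intro U hU' hBU
        simp only [Finset.mem_filter] at hU'
        exact H (hU U hU'.1.1 hU'.2 hBU ▸ hU'.1.2)
      · intro T hT'
        rw [Finset.mem_filter] at hT'
        by_contra hne
        exact H (hmono _ _ (hT T hT'.1 hne) hT'.2)
  refine ⟨hcard, fun F hF => ?_⟩
  by_cases hx : x ∈ F <;> by_cases hy : y ∈ F
  -- A boundary face through both `x` and `y` would force another one around the ridge `F \ y`. That
  -- one contains `x` but not `y`, against `hxface`.
  · by_contra hne
    have hxe : x ∈ F.erase y := Finset.mem_erase.2 ⟨hxy, hx⟩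
    obtain ⟨z, hz, hzy, hzne⟩ := exists_bd_insert_ne_zero (G := F.erase y) (z₀ := y) hcard
      (by have := Finset.card_erase_add_one hy; omega) (Finset.notMem_erase _ _)
      (by rwa [Finset.insert_erase hy])
    refine hzne ?_
    have hzx : z ≠ x := fun h => hz (h ▸ hxe)
    have hc := Finset.card_erase_add_one hxe
    have hc' := Finset.card_erase_add_one hy
    have hz' : z ∉ (F.erase y).erase x := fun h => hz (Finset.mem_of_mem_erase h)
    rw [← Finset.insert_erase hxe, Finset.insert_comm]
    refine hxface _ ?_ ?_ ?_
    · rw [Finset.card_insert_of_notMem hz']; omega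
    · simp [Ne.symm hzx]
    · simp [hzy.symm]
  · rw [← Finset.insert_erase hx]
    exact hxface _ (by rw [Finset.card_erase_add_one hx, hF]) (Finset.notMem_erase _ _)
      (fun h => hy (Finset.mem_of_mem_erase h))
  · have hB : (F.erase y).card + 1 = j := by rw [Finset.card_erase_add_one hy, hF]
    have hxB : x ∉ F.erase y := fun h => hx (Finset.mem_of_mem_erase h)
    rw [← hxface _ hB hxB (Finset.notMem_erase _ _), ← hsplit, ← hsplit (insert x _), hsum, hsum]
    congr 1
    · refine Finset.sum_congr rfl fun U hU => ?_
      simp only [Finset.mem_filter] at hU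
      conv_lhs => rw [← Finset.insert_erase hy]
      simp only [Finset.insert_subset_iff, hU.2.1, hU.2.2, true_and]
    · refine Finset.sum_congr rfl fun T hT => ?_
      rw [(h𝓟 T (Finset.mem_filter.1 hT).1).1.bd_eq_bd _ hB hxB (Finset.notMem_erase _ _),
        Finset.insert_erase hy]
  · rw [← hsplit, hsum, bd_eq_zero_of_forall, zero_add]
    · exact Finset.sum_eq_zero fun T hT =>
        (h𝓟 T (Finset.mem_filter.1 hT).1).1.bd_eq_zero F hF hx hy
    · intro U hU
      simp only [Finset.mem_filter] at hU
      exact not_subset_of_both_mem hxy (hC.1 U hU.1.1) hF hU.2.1 hU.2.2 hx hy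

/-- The cone over a `j`-circuit, `j ≥ 2`, is rigid in `ℝ^(j+2)` (Fogelsanger). -/
theorem IsCirc.infRigidOn_cone (hj : 2 ≤ j) {C : Finset (Finset α)} (hC : IsCirc j C)
    (hw : w ∉ verts C) {p : α → E (j + 2)} (hp : GenOn p (insert w (verts C))) :
    InfRigidOn (coneAdj C w) (insert w (verts C)) p := by
  classical
  induction hn : (verts C).card using Nat.strong_induction_on generalizing C with
  | _ n ih =>
  subst hn
  obtain ⟨⟨U₀, hU₀⟩, hcyc, hmin⟩ := hC
  obtain ⟨x, hx, y, hy, hxy⟩ := Finset.one_lt_card.1 (by rw [hcyc.1 U₀ hU₀]; omega : 1 < U₀.card)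
  obtain ⟨𝓟, h1, hdisj, hunion⟩ := exists_partition_minimal (IsRelCyc j x y)
    (fun _ _ h1 h2 h3 => h1.sdiff h2 h3) _ (hcyc.isRelCyc_filter hxy)
  have hTC : ∀ T ∈ 𝓟, T ⊆ C := fun T hT =>
    (Finset.subset_biUnion_of_mem id hT).trans (hunion ▸ Finset.filter_subset _ _)
  have hvTC : ∀ T ∈ 𝓟, verts T ⊆ verts C := fun T hT a ha => by
    obtain ⟨U, hU, haU⟩ := mem_verts.1 ha
    exact subset_verts (hTC T hT hU) haU
  intro q hq
  have h𝓟 : ∀ T ∈ 𝓟, IsRelCyc j x y T ∧ x ∈ verts T ∧ y ∈ verts T ∧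
      IsBody p q (insert w (verts T)) := by
    intro T hT
    obtain ⟨hTne, hTrel, hTmin⟩ := h1 T hT
    -- If `T` were a cycle it would be all of `C`, but no simplex of `T` contains `xy` while `U₀`
    -- does.
    have hTcyc : ¬ IsCyc j T := fun h => by
      have := hmin T (hTC T hT) hTne h
      exact hTrel.notMem U₀ (this ▸ hU₀) hx hy
    obtain ⟨hxT, hyT, hrig⟩ := hTrel.infRigidOn (w := w) (p := p) hj hxy hTne hTmin hTcyc
      (fun h => hw (hvTC T hT h)) (hp.mono (Finset.insert_subset_insert w (hvTC T hT)))
      (fun D hD hlt hwD hpD => ih _ (hlt.trans_le (Finset.card_le_card (hvTC T hT))) hD hwD hpD rfl)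
    refine ⟨hTrel, hxT, hyT, hrig q fun a ha b hb hab => ?_⟩
    refine hq a (Finset.insert_subset_insert w (hvTC T hT) ha) b
      (Finset.insert_subset_insert w (hvTC T hT) hb) ?_
    rcases hab with (⟨U, hU, hab⟩ | hab) | ⟨rfl, rfl⟩ | ⟨rfl, rfl⟩
    · exact Or.inl ⟨U, hTC T hT hU, hab⟩
    · exact Or.inr hab
    · exact Or.inl ⟨U₀, hU₀, hx, hy⟩
    · exact Or.inl ⟨U₀, hU₀, hy, hx⟩
  -- The neighbour of `U₀` across the face opposite `y` avoids `y`, so it lies in some part `T`. The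
  -- motion of this part is the candidate for the whole cone.
  obtain ⟨U₁, hU₁, hne, hsub⟩ := hcyc.exists_ne hU₀ (F := U₀.erase y)
    (by rw [Finset.card_erase_of_mem hy, hcyc.1 U₀ hU₀]; rfl) (Finset.erase_subset _ _)
  have hyU₁ : y ∉ U₁ := by
    intro h
    refine hne (Finset.eq_of_subset_of_card_le ?_ (by rw [hcyc.1 _ hU₁, hcyc.1 _ hU₀])).symm
    rw [← Finset.insert_erase hy, Finset.insert_subset_iff]
    exact ⟨h, hsub⟩
  have : U₁ ∈ 𝓟.biUnion id := by
    rw [hunion, Finset.mem_filter]; exact ⟨hU₁, fun h => hyU₁ h.2⟩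
  obtain ⟨T, hT, hU₁T⟩ := Finset.mem_biUnion.1 this
  obtain ⟨τ, hτ, hτq⟩ := (h𝓟 T hT).2.2.2
  have hfin := isCyc_filter_of_partition hcyc hxy hw hp h𝓟 hdisj hunion hτ
    (fun U => ∀ a ∈ insert w U, q a = τ.1 (p a) + τ.2) fun _ => Iff.rfl
  have heq := hmin _ (Finset.filter_subset _ _) ⟨U₁, Finset.mem_filter.2 ⟨hU₁, fun a ha =>
    hτq a (Finset.insert_subset_insert w (subset_verts hU₁T) ha)⟩⟩ hfin
  refine ⟨τ, hτ, fun a ha => ?_⟩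
  rcases Finset.mem_insert.1 ha with rfl | ha
  · exact hτq a (Finset.mem_insert_self _ _)
  · obtain ⟨U, hU, haU⟩ := mem_verts.1 ha
    rw [← heq, Finset.mem_filter] at hU
    exact hU.2 a (Finset.mem_insert_of_mem haU)

end Cone

/-! ### Rigidity of cycles in which few vertices are close to two coincident points -/

section Core

variable {α : Type*} [DecidableEq α] {j : ℕ}

def link (C : Finset (Finset α)) (w : α) : Finset (Finset α) :=
  (C.filter (w ∈ ·)).image (·.erase w)

theorem mem_link {C : Finset (Finset α)} {w : α} {X : Finset α} :
    X ∈ link C w ↔ w ∉ X ∧ insert w X ∈ C := by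
  simp only [link, Finset.mem_image, Finset.mem_filter]
  constructor
  · rintro ⟨U, ⟨hU, hw⟩, rfl⟩
    exact ⟨Finset.notMem_erase _ _, by rwa [Finset.insert_erase hw]⟩
  · rintro ⟨hw, hX⟩
    exact ⟨_, ⟨hX, Finset.mem_insert_self _ _⟩, Finset.erase_insert hw⟩

theorem bd_link {C : Finset (Finset α)} {w : α} {G : Finset α} (hw : w ∉ G) :
    bd (link C w) G = bd C (insert w G) := by
  have hinj : Set.InjOn (fun U : Finset α => U.erase w) (C.filter (w ∈ ·)) := by
    intro U hU V hV h
    rw [Finset.mem_coe, Finset.mem_filter] at hU hV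
    rw [← Finset.insert_erase hU.2, ← Finset.insert_erase hV.2]
    exact congrArg _ h
  rw [bd, link, Finset.sum_image hinj, bd, Finset.sum_filter]
  refine Finset.sum_congr rfl fun U _ => ?_
  simp only [Finset.insert_subset_iff, Finset.subset_erase, hw, not_false_eq_true, and_true,
    ite_and]

theorem IsCyc.link {C : Finset (Finset α)} (hC : IsCyc (j + 1) C) (w : α) :
    IsCyc j (link C w) := by
  refine ⟨fun X hX => ?_, fun G hG => ?_⟩
  · rw [mem_link] at hX
    have := hC.1 _ hX.2
    rw [Finset.card_insert_of_notMem hX.1] at this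
    omega
  · by_cases hw : w ∈ G
    · exact bd_eq_zero_of_forall fun X hX h => (mem_link.1 hX).1 (h hw)
    · rw [bd_link hw, hC.2 _ (by rw [Finset.card_insert_of_notMem hw, hG])]

/-- A `(j+1)`-cycle in which no simplex contains both `u` and `v`, realised so that only `u` and `v`
may coincide, together with a `(j+1)`-set `D` containing all common neighbours of `u` and `v`, and
velocities that preserve the edge lengths. -/
structure NearlyGenericFlex (S : Finset (Finset α)) (u v : α) (D : Finset α)
    (p q : α → E (j + 2)) : Prop where
  isCyc : IsCyc (j + 1) S
  genOn : ∀ A ⊆ verts S, (u ∈ A → v ∉ A) → GenOn p A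
  notMem : ∀ U ∈ S, u ∈ U → v ∉ U
  card_eq : D.card = j + 1
  mem_of_common : ∀ z, (∃ U ∈ S, z ∈ U ∧ u ∈ U) → (∃ U ∈ S, z ∈ U ∧ v ∈ U) → z ∈ D
  inner_eq_zero : ∀ U ∈ S, ∀ a ∈ U, ∀ b ∈ U, inner ℝ (p a - p b) (q a - q b) = 0

variable {S : Finset (Finset α)} {u v : α} {D : Finset α} {p q : α → E (j + 2)}

namespace NearlyGenericFlex

/-- The closed star of a vertex outside `D` never contains both `u` and `v`, so it is placed
generically and the cones over the circuits of its link are rigid. -/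
theorem exists_link_partition (h : NearlyGenericFlex S u v D p q) (hj : 2 ≤ j) {w : α}
    (hw : w ∉ D) :
    ∃ 𝓟 : Finset (Finset (Finset α)), (∀ T ∈ 𝓟, IsCyc j T ∧ IsBody p q (insert w (verts T))) ∧
      (𝓟 : Set (Finset (Finset α))).PairwiseDisjoint id ∧ 𝓟.biUnion id = link S w := by
  obtain ⟨𝓟, h1, h2, h3⟩ := (h.isCyc.link w).exists_circ_partition
  refine ⟨𝓟, fun T hT => ⟨(h1 T hT).2.1, ?_⟩, h2, h3⟩
  have hTl : ∀ X ∈ T, w ∉ X ∧ insert w X ∈ S := fun X hX =>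
    mem_link.1 (h3 ▸ Finset.mem_biUnion.2 ⟨T, hT, hX⟩)
  have hwT : w ∉ verts T := fun hw' => by
    obtain ⟨X, hX, hwX⟩ := mem_verts.1 hw'
    exact (hTl X hX).1 hwX
  have hsub : insert w (verts T) ⊆ verts S := by
    obtain ⟨X, hX⟩ := (h1 T hT).1
    intro a ha
    rcases Finset.mem_insert.1 ha with rfl | ha
    · exact subset_verts (hTl X hX).2 (Finset.mem_insert_self _ _)
    · obtain ⟨Y, hY, haY⟩ := mem_verts.1 ha
      exact subset_verts (hTl Y hY).2 (Finset.mem_insert_of_mem haY)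
  have hadj : ∀ a ∈ verts T, ∃ U ∈ S, w ∈ U ∧ a ∈ U := by
    intro a ha
    obtain ⟨Y, hY, haY⟩ := mem_verts.1 ha
    exact ⟨_, (hTl Y hY).2, Finset.mem_insert_self _ _, Finset.mem_insert_of_mem haY⟩
  have hgen := h.genOn _ hsub (by
    intro hu hv
    rcases Finset.mem_insert.1 hu with rfl | hu' <;> rcases Finset.mem_insert.1 hv with rfl | hv'
    · obtain ⟨a, ha⟩ := (h1 T hT).1
      exact h.notMem _ (hTl a ha).2 (Finset.mem_insert_self _ _) (Finset.mem_insert_self _ _)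
    · obtain ⟨U, hU, h4, h5⟩ := hadj _ hv'
      exact h.notMem U hU h4 h5
    · obtain ⟨U, hU, h4, h5⟩ := hadj _ hu'
      exact h.notMem U hU h5 h4
    · exact hw (h.mem_of_common w (hadj _ hu') (hadj _ hv')))
  refine (h1 T hT).infRigidOn_cone hj hwT hgen q fun a ha b hb hab => ?_
  rcases hab with ⟨X, hX, haX, hbX⟩ | rfl | rfl
  · exact h.inner_eq_zero _ (hTl X hX).2 a (Finset.mem_insert_of_mem haX) b
      (Finset.mem_insert_of_mem hbX)
  · rcases Finset.mem_insert.1 hb with rfl | hb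
    · simp
    · obtain ⟨U, hU, h4, h5⟩ := hadj _ hb
      exact h.inner_eq_zero U hU _ h4 _ h5
  · rcases Finset.mem_insert.1 ha with rfl | ha
    · simp
    · obtain ⟨U, hU, h4, h5⟩ := hadj _ ha
      exact h.inner_eq_zero U hU _ h5 _ h4

theorem motion_unique (h : NearlyGenericFlex S u v D p q) {A : Finset α} (hA : A ⊆ verts S)
    (huv : u ∈ A → v ∉ A) (hcard : j + 2 ≤ A.card)
    {τ σ : (E (j + 2) →ₗ[ℝ] E (j + 2)) × E (j + 2)}
    (hτ : τ ∈ trivialMotions (j + 2)) (hσ : σ ∈ trivialMotions (j + 2))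
    (hτA : ∀ a ∈ A, q a = τ.1 (p a) + τ.2) (hσA : ∀ a ∈ A, q a = σ.1 (p a) + σ.2) : τ = σ :=
  (h.genOn A hA huv).trivialMotion_unique (by omega) hcard hτ hσ fun a ha => by
    rw [← hτA a ha, hσA a ha]

/-- A simplex has `j + 2` vertices and `D` only `j + 1`, so some vertex of the simplex has a star
covered by rigid cones. -/
theorem exists_motion (h : NearlyGenericFlex S u v D p q) (hj : 2 ≤ j) {U : Finset α}
    (hU : U ∈ S) : IsBody p q U := by
  obtain ⟨w, hwU, hw⟩ : ∃ w ∈ U, w ∉ D := by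
    by_contra hn
    push Not at hn
    have := Finset.card_le_card hn
    rw [h.isCyc.1 U hU, h.card_eq] at this
    omega
  obtain ⟨𝓟, h1, -, h3⟩ := h.exists_link_partition hj hw
  have hmem : U.erase w ∈ 𝓟.biUnion id := by
    rw [h3, mem_link, Finset.insert_erase hwU]
    exact ⟨Finset.notMem_erase _ _, hU⟩
  obtain ⟨T, hT, hUT⟩ := Finset.mem_biUnion.1 hmem
  obtain ⟨τ, hτ, hτq⟩ := (h1 T hT).2
  refine ⟨τ, hτ, fun a ha => hτq a ?_⟩
  rw [← Finset.insert_erase hwU] at ha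
  exact Finset.insert_subset_insert w (subset_verts hUT) ha

/-- Around a vertex outside `D` the selected simplices form whole circuits of the link: a simplex
has `d` generic points and so determines the motion of its cone. Hence no face with a vertex outside
`D` is in the boundary. Only `D` itself remains, and a single face is not a boundary. -/
theorem isCyc_filter (h : NearlyGenericFlex S u v D p q) (hj : 2 ≤ j)
    {τ : (E (j + 2) →ₗ[ℝ] E (j + 2)) × E (j + 2)} (hτ : τ ∈ trivialMotions (j + 2))
    (P : Finset α → Prop) [DecidablePred P]
    (hP : ∀ U, P U ↔ ∀ a ∈ U, q a = τ.1 (p a) + τ.2) :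
    IsCyc (j + 1) (S.filter P) := by
  have hcard : ∀ U ∈ S.filter P, U.card = j + 2 := fun U hU =>
    h.isCyc.1 U (Finset.mem_filter.1 hU).1
  have hface : ∀ F : Finset α, F.card = j + 1 → ∀ w ∈ F, w ∉ D → bd (S.filter P) F = 0 := by
    intro F hF w hwF hw
    obtain ⟨𝓟, h1, h2, h3⟩ := h.exists_link_partition hj hw
    have hE : link (S.filter P) w = (𝓟.filter fun T => P (insert w (verts T))).biUnion id := by
      ext X
      rw [mem_link, Finset.mem_filter, Finset.mem_biUnion]
      constructor
      · rintro ⟨hwX, hX, hPX⟩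
        have hmem : X ∈ 𝓟.biUnion id := by rw [h3, mem_link]; exact ⟨hwX, hX⟩
        obtain ⟨T, hT, hXT⟩ := Finset.mem_biUnion.1 hmem
        refine ⟨T, Finset.mem_filter.2 ⟨hT, ?_⟩, hXT⟩
        obtain ⟨σ, hσ, hσq⟩ := (h1 T hT).2
        have : σ = τ := h.motion_unique (subset_verts hX) (h.notMem _ hX)
          (h.isCyc.1 _ hX).ge hσ hτ
          (fun a ha => hσq a (Finset.insert_subset_insert w (subset_verts hXT) ha))
          ((hP _).1 hPX)
        rw [hP, ← this]
        exact hσq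
      · rintro ⟨T, hT, hXT⟩
        rw [Finset.mem_filter] at hT
        have hmem : X ∈ 𝓟.biUnion id := Finset.mem_biUnion.2 ⟨T, hT.1, hXT⟩
        rw [h3, mem_link] at hmem
        refine ⟨hmem.1, hmem.2, ?_⟩
        rw [hP]
        exact fun a ha => (hP _).1 hT.2 a (Finset.insert_subset_insert w (subset_verts hXT) ha)
    rw [← Finset.insert_erase hwF, ← bd_link (Finset.notMem_erase _ _), hE,
      bd_biUnion (h2.subset fun T hT => (Finset.mem_filter.1 hT).1)]
    refine Finset.sum_eq_zero fun T hT => (h1 T (Finset.mem_filter.1 hT).1).1.2 _ ?_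
    rw [Finset.card_erase_of_mem hwF, hF]
    rfl
  refine ⟨hcard, fun F hF => ?_⟩
  by_cases hFD : F ⊆ D
  · obtain rfl : F = D := Finset.eq_of_subset_of_card_le hFD (by rw [hF, h.card_eq])
    by_contra hne
    obtain ⟨c, hc⟩ : F.Nonempty := Finset.card_pos.1 (by omega)
    obtain ⟨z, hz, hzc, hzne⟩ := exists_bd_insert_ne_zero (G := F.erase c) (z₀ := c) hcard
      (by rw [Finset.card_erase_of_mem hc, hF]; rfl) (Finset.notMem_erase _ _)
      (by rwa [Finset.insert_erase hc])
    refine hzne (hface _ ?_ z (Finset.mem_insert_self _ _)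
      fun hzF => hz (Finset.mem_erase.2 ⟨hzc, hzF⟩))
    rw [Finset.card_insert_of_notMem hz, Finset.card_erase_add_one hc, hF]
  · obtain ⟨w, hwF, hw⟩ := Finset.not_subset.1 hFD
    exact hface F hF w hwF hw

end NearlyGenericFlex

end Core

/-! ### Circuits in which the coincident points have at most `j + 1` common neighbours -/

section Coincident

variable {α : Type*} [DecidableEq α] {j : ℕ}

/-- Each face lies in exactly two facets of the simplex. Adding this cycle modulo two will remove
the simplices through the edge `uv`. -/
theorem isCyc_powersetCard (K : Finset α) (hK : K.card = j + 3) :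
    IsCyc (j + 1) (K.powersetCard (j + 2)) := by
  refine ⟨fun U hU => (Finset.mem_powersetCard.1 hU).2, fun F hF => ?_⟩
  by_cases hFK : F ⊆ K
  · have : (K.powersetCard (j + 2)).filter (F ⊆ ·) = (K \ F).image (insert · F) := by
      ext U
      simp only [Finset.mem_filter, Finset.mem_powersetCard, Finset.mem_image, Finset.mem_sdiff]
      constructor
      · rintro ⟨⟨hUK, hU⟩, hFU⟩
        obtain ⟨z, hz⟩ := Finset.card_eq_one.1
          (show (U \ F).card = 1 by rw [Finset.card_sdiff_of_subset hFU, hU, hF]; omega)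
        have hzU : z ∈ U \ F := hz ▸ Finset.mem_singleton_self z
        rw [Finset.mem_sdiff] at hzU
        refine ⟨z, ⟨hUK hzU.1, hzU.2⟩, ?_⟩
        rw [← Finset.sdiff_union_of_subset hFU, hz]
        rfl
      · rintro ⟨z, ⟨hzK, hzF⟩, rfl⟩
        exact ⟨⟨Finset.insert_subset hzK hFK, by rw [Finset.card_insert_of_notMem hzF, hF]⟩,
          Finset.subset_insert _ _⟩
    have hinj : Set.InjOn (fun z => insert z F) ↑(K \ F) := by
      intro a ha b _ hab
      rw [Finset.mem_coe, Finset.mem_sdiff] at ha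
      have : a ∈ insert b F := by
        rw [← show insert a F = insert b F from hab]; exact Finset.mem_insert_self _ _
      exact (Finset.mem_insert.1 this).resolve_right ha.2
    rw [bd_eq_card, this, Finset.card_image_of_injOn hinj, Finset.card_sdiff_of_subset hFK, hK, hF,
      show j + 3 - (j + 1) = 2 by omega]
    rfl
  · exact bd_eq_zero_of_forall fun U hU h => hFK (h.trans (Finset.mem_powersetCard.1 hU).1)

/-- The common neighbours of `u` and `v` in the graph of `S`. -/
def commonNbrs (S : Finset (Finset α)) (u v : α) : Finset α :=
  (verts S).filter fun z => z ≠ u ∧ z ≠ v ∧ (∃ U ∈ S, z ∈ U ∧ u ∈ U) ∧ ∃ U ∈ S, z ∈ U ∧ v ∈ U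

theorem mem_commonNbrs {S : Finset (Finset α)} {u v z : α} :
    z ∈ commonNbrs S u v ↔
      z ≠ u ∧ z ≠ v ∧ (∃ U ∈ S, z ∈ U ∧ u ∈ U) ∧ ∃ U ∈ S, z ∈ U ∧ v ∈ U := by
  rw [commonNbrs, Finset.mem_filter, and_iff_right_iff_imp]
  rintro ⟨-, -, ⟨U, hU, hz, -⟩, -⟩
  exact subset_verts hU hz

/-- Removing any `n` of the vertices leaves the graph of `S` connected. -/
def ConnectedAfter (S : Finset (Finset α)) (n : ℕ) : Prop :=
  ∀ X : Finset α, X.card = n → ∀ W : α → Prop, (∃ a ∈ verts S, a ∉ X ∧ W a) →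
    (∀ a b, a ∉ X → b ∉ X → (∃ U ∈ S, a ∈ U ∧ b ∈ U) → W a → W b) → ∀ b ∈ verts S, b ∉ X → W b

variable {S : Finset (Finset α)} {u v : α} {p q : α → E (j + 2)}

theorem IsCirc.isBody_of_nonadjacent (hj : 2 ≤ j) (hS : IsCirc (j + 1) S)
    (hgen : ∀ A ⊆ verts S, (u ∈ A → v ∉ A) → GenOn p A)
    (hflex : ∀ U ∈ S, ∀ a ∈ U, ∀ b ∈ U, inner ℝ (p a - p b) (q a - q b) = 0)
    (hcommon : (commonNbrs S u v).card ≤ j + 1) (hadj : ∀ U ∈ S, u ∈ U → v ∉ U) :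
    IsBody p q (verts S) := by
  classical
  obtain ⟨⟨U₀, hU₀⟩, hcyc, hmin⟩ := hS
  obtain ⟨D, hD, -, hDcard⟩ := Finset.exists_subsuperset_card_eq
    (Finset.filter_subset _ (verts S) : commonNbrs S u v ⊆ verts S) hcommon
    (by have := Finset.card_le_card (subset_verts hU₀)
        rw [hcyc.1 _ hU₀] at this; omega)
  have h : NearlyGenericFlex S u v D p q :=
    { isCyc := hcyc, genOn := hgen, notMem := hadj, card_eq := hDcard, inner_eq_zero := hflex
      mem_of_common := by
        intro z hu hv
        refine hD (mem_commonNbrs.2 ⟨?_, ?_, hu, hv⟩)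
        · rintro rfl; obtain ⟨U, hU, h1, h2⟩ := hv; exact hadj U hU h1 h2
        · rintro rfl; obtain ⟨U, hU, h1, h2⟩ := hu; exact hadj U hU h2 h1 }
  obtain ⟨τ, hτ, hτq⟩ := h.exists_motion hj hU₀
  have heq := hmin _ (Finset.filter_subset _ _) ⟨U₀, Finset.mem_filter.2 ⟨hU₀, hτq⟩⟩
    (h.isCyc_filter hj hτ (fun U => ∀ a ∈ U, q a = τ.1 (p a) + τ.2) fun _ => Iff.rfl)
  refine ⟨τ, hτ, fun a ha => ?_⟩
  obtain ⟨U, hU, haU⟩ := mem_verts.1 ha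
  rw [← heq, Finset.mem_filter] at hU
  exact hU.2 a haU

/-- The simplices through the edge `uv` of a cycle are precisely the facets of the simplex on
`D ∪ {u, v}` opposite to the points of `D`, when `D` has the least possible size. -/
theorem IsCyc.erase_mem (hS : IsCyc (j + 1) S) {D K : Finset α} (hK : K = insert u (insert v D))
    (hKcard : K.card = j + 3)
    (hsub : ∀ U ∈ S, u ∈ U → v ∈ U → U ⊆ K) {U₀ : Finset α} (hU₀ : U₀ ∈ S) (hu : u ∈ U₀)
    (hv : v ∈ U₀) {c : α} (hc : c ∈ D) (hcu : c ≠ u) (hcv : c ≠ v) : K.erase c ∈ S := by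
  have key : ∀ U ∈ S, u ∈ U → v ∈ U → ∃ c ∈ K, U = K.erase c := by
    intro U hU hu hv
    have h1 := hsub U hU hu hv
    obtain ⟨c, hc⟩ := Finset.card_eq_one.1 (show (K \ U).card = 1 by
      rw [Finset.card_sdiff_of_subset h1, hKcard, hS.1 U hU]; omega)
    have hcK : c ∈ K \ U := hc ▸ Finset.mem_singleton_self c
    rw [Finset.mem_sdiff] at hcK
    refine ⟨c, hcK.1, Finset.eq_of_subset_of_card_le ?_ ?_⟩
    · exact Finset.subset_erase.2 ⟨h1, hcK.2⟩
    · rw [Finset.card_erase_of_mem hcK.1, hKcard, hS.1 U hU]; rfl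
  obtain ⟨c₀, hc₀, rfl⟩ := key U₀ hU₀ hu hv
  by_cases hcc : c = c₀
  · rwa [hcc]
  have hcK : c ∈ K := by rw [hK]; simp [hc]
  have hcU : c ∈ K.erase c₀ := Finset.mem_erase.2 ⟨hcc, hcK⟩
  -- The simplex across the face `K \ {c₀, c}` still contains `u` and `v`, hence is a facet of `K`.
  -- Being different from `K \ c₀`, it must be `K \ c`.
  obtain ⟨U', hU', hne, hF⟩ := hS.exists_ne hU₀ (F := (K.erase c₀).erase c)
    (by rw [Finset.card_erase_of_mem hcU, hS.1 _ hU₀]; rfl) (Finset.erase_subset _ _)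
  obtain ⟨c', hc', rfl⟩ := key U' hU' (hF (Finset.mem_erase.2 ⟨hcu.symm, hu⟩))
    (hF (Finset.mem_erase.2 ⟨hcv.symm, hv⟩))
  by_cases h1 : c' = c
  · rwa [← h1]
  by_cases h2 : c' = c₀
  · exact absurd (by rw [h2]) hne
  · exact absurd (hF (Finset.mem_erase.2 ⟨h1, Finset.mem_erase.2 ⟨h2, hc'⟩⟩))
      (Finset.notMem_erase _ _)

/-- Adding the boundary of the simplex on `K = D ∪ {u, v}` leaves a cycle `S'` with no simplex
through `uv`, whose only possible new simplices are `K \ u` and `K \ v`. A motion carried by `S'`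
must be carried by one of these, since otherwise its simplices form a proper subcycle of `S`. So at
most two motions occur, and if they differ, their simplices can meet only in vertices of `D`,
against connectivity. -/
theorem IsCirc.isBody_of_adjacent (hj : 2 ≤ j) (hS : IsCirc (j + 1) S) (huv : u ≠ v)
    (hgen : ∀ A ⊆ verts S, (u ∈ A → v ∉ A) → GenOn p A)
    (hflex : ∀ U ∈ S, ∀ a ∈ U, ∀ b ∈ U, inner ℝ (p a - p b) (q a - q b) = 0)
    (hcommon : (commonNbrs S u v).card ≤ j + 1) (hcard : j + 4 ≤ (verts S).card)
    (hconn : ConnectedAfter S (j + 2)) {U₀ : Finset α} (hU₀ : U₀ ∈ S) (hu : u ∈ U₀)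
    (hv : v ∈ U₀) : IsBody p q (verts S) := by
  classical
  obtain ⟨-, hcyc, hmin⟩ := hS
  have huS := subset_verts hU₀ hu
  have hvS := subset_verts hU₀ hv
  obtain ⟨D, hND, hDS, hDcard⟩ := Finset.exists_subsuperset_card_eq
    (show commonNbrs S u v ⊆ ((verts S).erase u).erase v by
      intro z hz
      rw [Finset.mem_erase, Finset.mem_erase]
      have h := mem_commonNbrs.1 hz
      exact ⟨h.2.1, h.1, (Finset.mem_filter.1 hz).1⟩) hcommon
    (by rw [Finset.card_erase_of_mem (Finset.mem_erase.2 ⟨huv.symm, hvS⟩),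
          Finset.card_erase_of_mem huS]; omega)
  have huD : u ∉ D := fun h => by simpa using hDS h
  have hvD : v ∉ D := fun h => by simpa using hDS h
  have hDS' : D ⊆ verts S := hDS.trans ((Finset.erase_subset _ _).trans (Finset.erase_subset _ _))
  obtain ⟨K, hK⟩ : ∃ K, K = insert u (insert v D) := ⟨_, rfl⟩
  have hKcard : K.card = j + 3 := by
    rw [hK, Finset.card_insert_of_notMem (by simp [huv, huD]), Finset.card_insert_of_notMem hvD,
      hDcard]
  have huK : u ∈ K := by simp [hK]
  have hvK : v ∈ K := by simp [hK]
  have hDK : D ⊆ K := by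
    rw [hK]; exact (Finset.subset_insert _ _).trans (Finset.subset_insert _ _)
  have hKS : K ⊆ verts S := by
    rw [hK]; exact Finset.insert_subset huS (Finset.insert_subset hvS hDS')
  have hKD : ∀ a ∈ K, a ≠ u → a ≠ v → a ∈ D := by
    intro a ha h1 h2
    rw [hK] at ha
    simpa [h1, h2] using ha
  have hsubK : ∀ U ∈ S, u ∈ U → v ∈ U → U ⊆ K := by
    intro U hU hu hv z hz
    by_cases hzu : z = u
    · exact hzu ▸ huK
    by_cases hzv : z = v
    · exact hzv ▸ hvK
    exact hDK (hND (mem_commonNbrs.2 ⟨hzu, hzv, ⟨U, hU, hz, hu⟩, ⟨U, hU, hz, hv⟩⟩))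
  have herase : ∀ c ∈ D, K.erase c ∈ S := fun c hc =>
    hcyc.erase_mem hK hKcard hsubK hU₀ hu hv hc (fun h => huD (h ▸ hc)) fun h => hvD (h ▸ hc)
  obtain ⟨S', hS'⟩ : ∃ S', S' = symmDiff S (K.powersetCard (j + 2)) := ⟨_, rfl⟩
  have hmem : ∀ U ∈ S, ¬ U ⊆ K → U ∈ S' := by
    intro U hU hUK
    rw [hS', Finset.mem_symmDiff]
    exact Or.inl ⟨hU, fun h => hUK (Finset.mem_powersetCard.1 h).1⟩
  have hcases : ∀ U ∈ S', (U ∈ S ∧ ¬ U ⊆ K) ∨ (U ∉ S ∧ (U = K.erase u ∨ U = K.erase v)) := by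
    intro U hU
    rw [hS', Finset.mem_symmDiff, Finset.mem_powersetCard] at hU
    rcases hU with ⟨h1, h2⟩ | ⟨⟨h1, h2⟩, h3⟩
    · exact Or.inl ⟨h1, fun h => h2 ⟨h, hcyc.1 U h1⟩⟩
    · refine Or.inr ⟨h3, ?_⟩
      obtain ⟨c, hc⟩ := Finset.card_eq_one.1 (show (K \ U).card = 1 by
        rw [Finset.card_sdiff_of_subset h1, hKcard, h2]; omega)
      have hcK : c ∈ K \ U := hc ▸ Finset.mem_singleton_self c
      rw [Finset.mem_sdiff] at hcK
      have hU : U = K.erase c := Finset.eq_of_subset_of_card_le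
        (Finset.subset_erase.2 ⟨h1, hcK.2⟩)
        (by rw [Finset.card_erase_of_mem hcK.1, hKcard, h2]; rfl)
      by_cases hcu : c = u
      · exact Or.inl (hcu ▸ hU)
      by_cases hcv : c = v
      · exact Or.inr (hcv ▸ hU)
      exact absurd (hU ▸ herase c (hKD c hcK.1 hcu hcv)) h3
  have hnotMem : ∀ U ∈ S', u ∈ U → v ∉ U := by
    intro U hU h1 h2
    rcases hcases U hU with ⟨h3, h4⟩ | ⟨-, rfl | rfl⟩
    · exact h4 (hsubK U h3 h1 h2)
    · exact Finset.notMem_erase _ _ h1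
    · exact Finset.notMem_erase _ _ h2
  have hvS' : verts S' ⊆ verts S := by
    intro a ha
    obtain ⟨U, hU, haU⟩ := mem_verts.1 ha
    rcases hcases U hU with ⟨h3, -⟩ | ⟨-, rfl | rfl⟩
    · exact subset_verts h3 haU
    · exact hKS (Finset.mem_of_mem_erase haU)
    · exact hKS (Finset.mem_of_mem_erase haU)
  have hKflex : ∀ a ∈ K, ∀ b ∈ K, inner ℝ (p a - p b) (q a - q b) = 0 := by
    intro a ha b hb
    -- As `j + 1 ≥ 3`, some `c ∈ D` differs from `a` and `b`, and the facet `K \ c` of `S` contains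
    -- both.
    obtain ⟨c, hc⟩ : ((D.erase a).erase b).Nonempty := by
      have h1 := Finset.pred_card_le_card_erase (s := D) (a := a)
      have h2 := Finset.pred_card_le_card_erase (s := D.erase a) (a := b)
      exact Finset.card_pos.1 (by omega)
    rw [Finset.mem_erase, Finset.mem_erase] at hc
    exact hflex _ (herase c hc.2.2) a (Finset.mem_erase.2 ⟨hc.2.1.symm, ha⟩) b
      (Finset.mem_erase.2 ⟨hc.1.symm, hb⟩)
  have h : NearlyGenericFlex S' u v D p q :=
    { isCyc := hS' ▸ hcyc.symmDiff (isCyc_powersetCard K hKcard)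
      genOn := fun A hA => hgen A (hA.trans hvS')
      notMem := hnotMem
      card_eq := hDcard
      mem_of_common := by
        rintro z ⟨U, hU, hzU, huU⟩ ⟨U', hU', hzU', hvU'⟩
        have hzu : z ≠ u := by rintro rfl; exact hnotMem U' hU' hzU' hvU'
        have hzv : z ≠ v := by rintro rfl; exact hnotMem U hU huU hzU
        by_cases hzK : z ∈ K
        · exact hKD z hzK hzu hzv
        · have hin : ∀ U ∈ S', z ∈ U → U ∈ S := by
            intro U hU hz
            rcases hcases U hU with ⟨h3, -⟩ | ⟨-, rfl | rfl⟩
            · exact h3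
            · exact absurd (Finset.mem_of_mem_erase hz) hzK
            · exact absurd (Finset.mem_of_mem_erase hz) hzK
          exact hND (mem_commonNbrs.2 ⟨hzu, hzv, ⟨U, hin U hU hzU, hzU, huU⟩,
            ⟨U', hin U' hU' hzU', hzU', hvU'⟩⟩)
      inner_eq_zero := by
        intro U hU a ha b hb
        rcases hcases U hU with ⟨h3, -⟩ | ⟨-, rfl | rfl⟩
        · exact hflex U h3 a ha b hb
        · exact hKflex a (Finset.mem_of_mem_erase ha) b (Finset.mem_of_mem_erase hb)
        · exact hKflex a (Finset.mem_of_mem_erase ha) b (Finset.mem_of_mem_erase hb) }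
  let P : (E (j + 2) →ₗ[ℝ] E (j + 2)) × E (j + 2) → Finset α → Prop :=
    fun τ U => ∀ a ∈ U, q a = τ.1 (p a) + τ.2
  have huniq : ∀ U ∈ S', ∀ τ ∈ trivialMotions (j + 2), ∀ σ ∈ trivialMotions (j + 2),
      P τ U → P σ U → τ = σ := fun U hU τ hτ σ hσ h1 h2 =>
    h.motion_unique (subset_verts hU) (h.notMem U hU) (h.isCyc.1 U hU).ge hτ hσ h1 h2
  have hkey : ∀ τ ∈ trivialMotions (j + 2), ∀ U ∈ S', P τ U →
      (K.erase v ∈ S' ∧ P τ (K.erase v)) ∨ (K.erase u ∈ S' ∧ P τ (K.erase u)) := by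
    intro τ hτ U hU hPU
    have hc := h.isCyc_filter hj hτ (P τ) fun _ => Iff.rfl
    by_cases hsub : S'.filter (P τ) ⊆ S
    · have := hmin _ hsub ⟨U, Finset.mem_filter.2 ⟨hU, hPU⟩⟩ hc
      rw [← this, Finset.mem_filter] at hU₀
      exact absurd hv (hnotMem U₀ hU₀.1 hu)
    · obtain ⟨U', hU', hn⟩ := Finset.not_subset.1 hsub
      rw [Finset.mem_filter] at hU'
      rcases hcases U' hU'.1 with ⟨h3, -⟩ | ⟨-, rfl | rfl⟩
      · exact absurd h3 hn
      · exact Or.inr hU'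
      · exact Or.inl hU'
  -- Otherwise all simplices of `S` through `c` lie in `K`, and deleting the other `j + 2` vertices
  -- of `K` isolates `c`, although `S` has at least `j + 4` vertices.
  have hdeg : ∀ c, (c = u ∨ c = v) → ∃ U ∈ S', c ∈ U := by
    intro c hc
    have hcK : c ∈ K := by rcases hc with rfl | rfl <;> assumption
    by_contra hn
    push Not at hn
    have := hconn (K.erase c) (by rw [Finset.card_erase_of_mem hcK, hKcard]; rfl) (· = c)
      ⟨c, hKS hcK, Finset.notMem_erase _ _, rfl⟩ (by
        rintro a b - hb ⟨U, hU, haU, hbU⟩ rfl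
        by_contra hba
        have hbK : b ∉ K := fun h => hb (Finset.mem_erase.2 ⟨hba, h⟩)
        exact hn U (hmem U hU fun h => hbK (h hbU)) haU)
    have hle : verts S ⊆ K := by
      intro b hb
      by_cases hbX : b ∈ K.erase c
      · exact Finset.mem_of_mem_erase hbX
      · rw [this b hb hbX]; exact hcK
    have := Finset.card_le_card hle
    omega
  obtain ⟨Uu, hUu, huUu⟩ := hdeg u (Or.inl rfl)
  obtain ⟨Uv, hUv, hvUv⟩ := hdeg v (Or.inr rfl)
  have hDe : D ⊆ K.erase u ∧ D ⊆ K.erase v :=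
    ⟨Finset.subset_erase.2 ⟨hDK, huD⟩, Finset.subset_erase.2 ⟨hDK, hvD⟩⟩
  have hone : ∃ τ ∈ trivialMotions (j + 2), ∀ U ∈ S', P τ U := by
    by_cases h1 : K.erase v ∈ S' <;> by_cases h2 : K.erase u ∈ S'
    · obtain ⟨τ₁, hτ₁, hq₁⟩ := h.exists_motion hj h1
      obtain ⟨τ₂, hτ₂, hq₂⟩ := h.exists_motion hj h2
      have hor : ∀ σ ∈ trivialMotions (j + 2), ∀ U ∈ S', P σ U → σ = τ₁ ∨ σ = τ₂ := by
        intro σ hσ U hU hPU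
        rcases hkey σ hσ U hU hPU with h3 | h3
        · exact Or.inl (huniq _ h1 σ hσ τ₁ hτ₁ h3.2 hq₁)
        · exact Or.inr (huniq _ h2 σ hσ τ₂ hτ₂ h3.2 hq₂)
      by_cases hττ : τ₁ = τ₂
      · refine ⟨τ₁, hτ₁, fun U hU => ?_⟩
        obtain ⟨σ, hσ, hσq⟩ := h.exists_motion hj hU
        have : σ = τ₁ := by simpa [hττ] using hor σ hσ U hU hσq
        exact this ▸ hσq
      · exfalso
        -- A vertex outside `D` in both classes would give, with `D`, `d` generic points on which
        -- the two motions agree.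
        have hsep : ∀ a, a ∉ D → (∃ U ∈ S', a ∈ U ∧ P τ₁ U) → ¬ ∃ U ∈ S', a ∈ U ∧ P τ₂ U := by
          rintro a haD ⟨U₁, hU₁, haU₁, hP₁⟩ ⟨U₂, hU₂, haU₂, hP₂⟩
          refine hττ (h.motion_unique (A := insert a D) ?_ ?_ ?_ hτ₁ hτ₂ ?_ ?_)
          · exact Finset.insert_subset (subset_verts hU₁ haU₁) (hDe.1.trans (subset_verts h2))
          · intro h3 h4
            have h3' := (Finset.mem_insert.1 h3).resolve_right huD
            have h4' := (Finset.mem_insert.1 h4).resolve_right hvD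
            exact huv (h3'.trans h4'.symm)
          · rw [Finset.card_insert_of_notMem haD, hDcard]
          · intro b hb
            rcases Finset.mem_insert.1 hb with rfl | hb
            · exact hP₁ _ haU₁
            · exact hq₁ _ (hDe.2 hb)
          · intro b hb
            rcases Finset.mem_insert.1 hb with rfl | hb
            · exact hP₂ _ haU₂
            · exact hq₂ _ (hDe.1 hb)
        -- The simplex across `D` from `K \ v` in the cycle of `τ₁` provides a vertex of that class
        -- outside `K \ v`, from which to start.
        obtain ⟨U', hU', hne, hDU'⟩ := (h.isCyc_filter hj hτ₁ (P τ₁) fun _ => Iff.rfl).exists_ne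
          (Finset.mem_filter.2 ⟨h1, hq₁⟩) hDcard hDe.2
        rw [Finset.mem_filter] at hU'
        obtain ⟨a, haU', ha⟩ : ∃ a ∈ U', a ∉ K.erase v := by
          by_contra hn
          push Not at hn
          exact hne (Finset.eq_of_subset_of_card_le hn
            (by rw [h.isCyc.1 _ hU'.1, h.isCyc.1 _ h1]))
        have hXD : ∀ a, a ∉ K.erase v → a ∉ D := fun a ha haD => ha (hDe.2 haD)
        -- After deleting the `j + 2` vertices of `K \ v`, the property of lying in a simplex moving
        -- with `τ₁` spreads along edges, hence reaches `v`. But `v` lies in `K \ u`, which moves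
        -- with `τ₂`.
        have hW := hconn (K.erase v) (h.isCyc.1 _ h1) (fun a => ∃ U ∈ S', a ∈ U ∧ P τ₁ U)
          ⟨a, hvS' (subset_verts hU'.1 haU'), ha, U', hU'.1, haU', hU'.2⟩ (by
            rintro a b ha hb ⟨U, hU, haU, hbU⟩ hWa
            by_cases hUK : U ⊆ K
            · have h3 : a = v := by
                by_contra hav; exact ha (Finset.mem_erase.2 ⟨hav, hUK haU⟩)
              have h4 : b = v := by
                by_contra hbv; exact hb (Finset.mem_erase.2 ⟨hbv, hUK hbU⟩)
              rw [h4, ← h3]; exact hWa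
            · have hUS' := hmem U hU hUK
              obtain ⟨σ, hσ, hσq⟩ := h.exists_motion hj hUS'
              rcases hor σ hσ U hUS' hσq with rfl | rfl
              · exact ⟨U, hUS', hbU, hσq⟩
              · exact absurd ⟨U, hUS', haU, hσq⟩ (hsep a (hXD a ha) hWa))
          v hvS (Finset.notMem_erase _ _)
        exact hsep v hvD hW ⟨_, h2, Finset.mem_erase.2 ⟨huv.symm, hvK⟩, hq₂⟩
    · obtain ⟨τ₁, hτ₁, hq₁⟩ := h.exists_motion hj h1
      refine ⟨τ₁, hτ₁, fun U hU => ?_⟩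
      obtain ⟨σ, hσ, hσq⟩ := h.exists_motion hj hU
      rcases hkey σ hσ U hU hσq with h3 | h3
      · rw [huniq _ h1 τ₁ hτ₁ σ hσ hq₁ h3.2]; exact hσq
      · exact absurd h3.1 h2
    · obtain ⟨τ₂, hτ₂, hq₂⟩ := h.exists_motion hj h2
      refine ⟨τ₂, hτ₂, fun U hU => ?_⟩
      obtain ⟨σ, hσ, hσq⟩ := h.exists_motion hj hU
      rcases hkey σ hσ U hU hσq with h3 | h3
      · exact absurd h3.1 h1
      · rw [huniq _ h2 τ₂ hτ₂ σ hσ hq₂ h3.2]; exact hσq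
    · obtain ⟨σ, hσ, hσq⟩ := h.exists_motion hj hUu
      rcases hkey σ hσ Uu hUu hσq with h3 | h3
      · exact absurd h3.1 h1
      · exact absurd h3.1 h2
  obtain ⟨τ, hτ, hall⟩ := hone
  refine ⟨τ, hτ, fun a ha => ?_⟩
  by_cases haK : a ∈ K
  · by_cases hau : a = u
    · exact hau ▸ hall Uu hUu u huUu
    by_cases hav : a = v
    · exact hav ▸ hall Uv hUv v hvUv
    have haD := hKD a haK hau hav
    rcases hkey τ hτ Uu hUu (hall Uu hUu) with h3 | h3
    · exact h3.2 a (hDe.2 haD)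
    · exact h3.2 a (hDe.1 haD)
  · obtain ⟨U, hU, haU⟩ := mem_verts.1 ha
    exact hall U (hmem U hU fun h => haK (h haU)) a haU

theorem IsCirc.isBody_of_card_commonNbrs_le (hj : 2 ≤ j) (hS : IsCirc (j + 1) S) (huv : u ≠ v)
    (hgen : ∀ A ⊆ verts S, (u ∈ A → v ∉ A) → GenOn p A)
    (hflex : ∀ U ∈ S, ∀ a ∈ U, ∀ b ∈ U, inner ℝ (p a - p b) (q a - q b) = 0)
    (hcommon : (commonNbrs S u v).card ≤ j + 1) (hcard : j + 4 ≤ (verts S).card)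
    (hconn : ConnectedAfter S (j + 2)) : IsBody p q (verts S) := by
  by_cases hadj : ∀ U ∈ S, u ∈ U → v ∉ U
  · exact hS.isBody_of_nonadjacent hj hgen hflex hcommon hadj
  · push Not at hadj
    obtain ⟨U₀, hU₀, hu, hv⟩ := hadj
    exact hS.isBody_of_adjacent hj huv hgen hflex hcommon hcard hconn hU₀ hu hv

end Coincident

/-! ### Rigid generic frameworks are infinitesimally rigid -/

open Topology in
/-- A vector in the kernel of the derivative of the quadratic map `z ↦ B z z` at a point where this
kernel has the least dimension is tangent to a curve in the fibre. -/
theorem exists_curve_in_fibre {N F : Type*} [NormedAddCommGroup N] [NormedSpace ℝ N]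
    [FiniteDimensional ℝ N] [NormedAddCommGroup F] [NormedSpace ℝ F] [FiniteDimensional ℝ F]
    (B : N →L[ℝ] N →L[ℝ] F) (hB : ∀ x y, B x y = B y x) (p : N)
    (hp : ∀ z, Module.finrank ℝ (LinearMap.ker (B p : N →ₗ[ℝ] F)) ≤
      Module.finrank ℝ (LinearMap.ker (B z : N →ₗ[ℝ] F))) (v : N) (hv : B p v = 0) :
    ∃ γ : ℝ → N, ∃ ε > 0, γ 0 = p ∧ HasDerivAt γ v 0 ∧ ContinuousOn γ (Metric.ball 0 ε) ∧
      ∀ t ∈ Metric.ball (0 : ℝ) ε, B (γ t) (γ t) = B p p := by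
  have : CompleteSpace N := FiniteDimensional.complete ℝ N
  let W := LinearMap.range (B p : N →ₗ[ℝ] F)
  let K := LinearMap.ker (B p : N →ₗ[ℝ] F)
  obtain ⟨π₀, hπ₀⟩ := LinearMap.exists_leftInverse_of_injective W.subtype W.ker_subtype
  obtain ⟨κ₀, hκ₀⟩ := LinearMap.exists_leftInverse_of_injective K.subtype K.ker_subtype
  let π : F →L[ℝ] W := LinearMap.toContinuousLinearMap π₀
  let κ : N →L[ℝ] K := LinearMap.toContinuousLinearMap κ₀
  have hπ : ∀ w : W, π w = w := fun w => LinearMap.congr_fun hπ₀ w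
  have hκ : ∀ w : K, κ w = w := fun w => LinearMap.congr_fun hκ₀ w
  -- The kernel component makes `Φ` a local diffeomorphism at `p`, so the line `Φ p + t (0, v)` can
  -- be lifted. The lift keeps only the projection of `B z z` to `W` constant; the other components
  -- need the minimality `hp`.
  let Φ : N → W × K := fun z => (π (B z z), κ z)
  let D : N →L[ℝ] W × K := ((2 : ℝ) • π.comp (B p)).prod κ
  have hquad : ∀ z, HasFDerivAt (fun z => B z z) ((2 : ℝ) • B z) z := by
    intro z
    have := (B.hasFDerivAt (x := z)).clm_apply (hasFDerivAt_id z)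
    convert! this using 1
    ext y
    simp [hB y z, two_smul]
  have hDinj : Function.Injective D := by
    rw [injective_iff_map_eq_zero]
    intro z hz
    have h1 : (2 : ℝ) • π (B p z) = 0 := congrArg Prod.fst hz
    have h2 : κ z = 0 := congrArg Prod.snd hz
    have h3 : π (B p z) = 0 := (smul_eq_zero.1 h1).resolve_left two_ne_zero
    have h4 := hπ ⟨B p z, ⟨z, rfl⟩⟩
    have h5 : B p z = 0 := by
      have := h4.symm.trans h3
      exact congrArg Subtype.val this
    have h6 := hκ ⟨z, h5⟩
    exact congrArg Subtype.val (h6.symm.trans h2)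
  have hdim : Module.finrank ℝ N = Module.finrank ℝ (W × K) := by
    rw [Module.finrank_prod]; exact (LinearMap.finrank_range_add_finrank_ker _).symm
  let e : N ≃L[ℝ] W × K :=
    (LinearEquiv.ofInjectiveOfFinrankEq (D : N →ₗ[ℝ] W × K) hDinj hdim).toContinuousLinearEquiv
  have he : (e : N →L[ℝ] W × K) = D := by ext1 z; rfl
  have hΦd : HasFDerivAt Φ (e : N →L[ℝ] W × K) p := by
    rw [he]
    have h1 : HasFDerivAt (fun z => π (B z z)) (π.comp ((2 : ℝ) • B p)) p :=
      π.hasFDerivAt.comp p (hquad p)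
    rw [ContinuousLinearMap.comp_smul] at h1
    exact h1.prodMk κ.hasFDerivAt
  have hΦc : ContDiffAt ℝ 1 Φ p :=
    ((π.contDiff.comp (B.contDiff.clm_apply contDiff_id)).prodMk κ.contDiff).contDiffAt
  let g := hΦc.localInverse hΦd one_ne_zero
  have hgc : ContDiffAt ℝ 1 g (Φ p) := hΦc.to_localInverse hΦd one_ne_zero
  have hgp : g (Φ p) = p := hΦc.localInverse_apply_image hΦd one_ne_zero
  have hgd : HasFDerivAt g (e.symm : W × K →L[ℝ] N) (Φ p) :=
    (hΦc.hasStrictFDerivAt' hΦd one_ne_zero).to_localInverse.hasFDerivAt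
  have hgr : ∀ᶠ y in 𝓝 (Φ p), Φ (g y) = y :=
    (hΦc.hasStrictFDerivAt' hΦd one_ne_zero).eventually_right_inverse
  let ℓ : ℝ → W × K := fun t => Φ p + t • (0, ⟨v, hv⟩)
  have hℓ0 : ℓ 0 = Φ p := by simp [ℓ]
  have hℓd : ∀ t, HasDerivAt ℓ (0, ⟨v, hv⟩) t := by
    intro t
    have h1 := ((hasDerivAt_id t).smul_const ((0, ⟨v, hv⟩) : W × K)).const_add (Φ p)
    rw [one_smul] at h1
    exact h1
  have hℓc : ContinuousAt ℓ 0 := (hℓd 0).continuousAt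
  -- Near `p` the map `π ∘ B z` is still onto `W`, and by `hp` the rank of `B z` is at most `dim W`.
  -- Hence the two kernels coincide.
  have hker : ∀ᶠ z in 𝓝 p, ∀ y, π (B z y) = 0 → B z y = 0 := by
    have hopen := isOpen_setOfPred_nat_le_rank (𝕜 := ℝ) (E := N) (F := W) (Module.finrank ℝ W)
    have hcont : Continuous fun z => π.comp (B z) := by fun_prop
    have hmem : π.comp (B p) ∈ {f : N →L[ℝ] W | ((Module.finrank ℝ W : ℕ) : Cardinal) ≤
        (f : N →ₗ[ℝ] W).rank} := by
      have hr : LinearMap.range (π.comp (B p) : N →ₗ[ℝ] W) = ⊤ := by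
        rw [LinearMap.range_eq_top]
        rintro ⟨_, z, rfl⟩
        exact ⟨z, hπ ⟨B p z, ⟨z, rfl⟩⟩⟩
      change ((Module.finrank ℝ W : ℕ) : Cardinal) ≤ Module.rank ℝ (LinearMap.range _)
      rw [hr, rank_top, Module.finrank_eq_rank]
    filter_upwards [hcont.continuousAt.preimage_mem_nhds (hopen.mem_nhds hmem)] with z hz y hy
    have hz' : Module.finrank ℝ W ≤ Module.finrank ℝ (LinearMap.range
        (π.comp (B z) : N →ₗ[ℝ] W)) := by
      have h1 : ((Module.finrank ℝ W : ℕ) : Cardinal) ≤ Module.rank ℝ (LinearMap.range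
        (π.comp (B z) : N →ₗ[ℝ] W)) := hz
      rw [← Module.finrank_eq_rank] at h1
      exact_mod_cast h1
    have h1 := LinearMap.finrank_range_add_finrank_ker (π.comp (B z) : N →ₗ[ℝ] W)
    have h2 := LinearMap.finrank_range_add_finrank_ker (B p : N →ₗ[ℝ] F)
    have h3 := hp z
    have hle : LinearMap.ker (B z : N →ₗ[ℝ] F) ≤ LinearMap.ker (π.comp (B z) : N →ₗ[ℝ] W) := by
      intro y hy
      rw [LinearMap.mem_ker] at hy ⊢
      change π (B z y) = 0
      have hy' : B z y = 0 := hy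
      rw [hy', map_zero]
    have heq := Submodule.eq_of_le_of_finrank_le hle (by
      change _ + _ = _ at h2
      have h4 : Module.finrank ℝ (LinearMap.range (B p : N →ₗ[ℝ] F)) = Module.finrank ℝ W := rfl
      omega)
    have hy' : y ∈ LinearMap.ker (π.comp (B z) : N →ₗ[ℝ] W) := hy
    rw [← heq] at hy'
    exact hy'
  have hgℓ : ContinuousAt (fun t => g (ℓ t)) 0 := by
    refine ContinuousAt.comp (g := g) ?_ hℓc
    rw [hℓ0]; exact hgc.continuousAt
  have hev : ∀ᶠ t in 𝓝 (0 : ℝ), ContDiffAt ℝ 1 g (ℓ t) ∧ Φ (g (ℓ t)) = ℓ t ∧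
      ∀ y, π (B (g (ℓ t)) y) = 0 → B (g (ℓ t)) y = 0 := by
    have h1 := hℓc.eventually (hℓ0.symm ▸ hgc.eventually (by simp))
    have h2 := hℓc.eventually (hℓ0.symm ▸ hgr)
    have h3 : ∀ᶠ t in 𝓝 (0 : ℝ), ∀ y, π (B (g (ℓ t)) y) = 0 → B (g (ℓ t)) y = 0 :=
      hgℓ.eventually (p := fun z => ∀ y, π (B z y) = 0 → B z y = 0)
        (by simpa only [hℓ0, hgp] using hker)
    exact h1.and (h2.and h3)
  obtain ⟨ε, hε, hball⟩ := Metric.eventually_nhds_iff_ball.1 hev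
  have hγd : ∀ t ∈ Metric.ball (0 : ℝ) ε, DifferentiableAt ℝ (fun t => g (ℓ t)) t := fun t ht =>
    (((hball t ht).1.differentiableAt one_ne_zero).comp t (hℓd t).differentiableAt)
  refine ⟨fun t => g (ℓ t), ε, hε, by simp only [hℓ0, hgp], ?_, ?_, ?_⟩
  · have h1 : HasFDerivAt g (e.symm : W × K →L[ℝ] N) (ℓ 0) := hℓ0.symm ▸ hgd
    have h2 := h1.comp_hasDerivAt (0 : ℝ) (hℓd 0)
    have h3 : e v = (0, ⟨v, hv⟩) := by
      have : e v = D v := by rw [← he]; rfl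
      rw [this]
      refine Prod.ext ?_ (hκ ⟨v, hv⟩)
      change (2 : ℝ) • π (B p v) = 0
      rw [hv, map_zero, smul_zero]
    have h4 : (e.symm : W × K →L[ℝ] N) (0, ⟨v, hv⟩) = v := by
      rw [← h3]; exact e.symm_apply_apply v
    rwa [h4] at h2
  · exact fun t ht => (hγd t ht).continuousAt.continuousWithinAt
  · have hcomp : ∀ t ∈ Metric.ball (0 : ℝ) ε, HasDerivAt (fun t => B (g (ℓ t)) (g (ℓ t))) 0 t := by
      intro t ht
      have h1 := (hγd t ht).hasDerivAt
      have h2 := (hquad (g (ℓ t))).comp_hasDerivAt t h1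
      have h3 := π.hasFDerivAt.comp_hasDerivAt t h2
      have h4 : HasDerivAt (fun t => π (B (g (ℓ t)) (g (ℓ t)))) 0 t := by
        refine (hasDerivAt_const t (π (B p p))).congr_of_eventuallyEq ?_
        filter_upwards [Metric.isOpen_ball.mem_nhds ht] with s hs
        have := congrArg Prod.fst (hball s hs).2.1
        simpa [Φ, ℓ] using this
      have h5 := h3.unique h4
      have h6 : π (B (g (ℓ t)) (deriv (fun t => g (ℓ t)) t)) = 0 := by
        have : (2 : ℝ) • π (B (g (ℓ t)) (deriv (fun t => g (ℓ t)) t)) = 0 := by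
          rw [← map_smul]; exact h5
        exact (smul_eq_zero.1 this).resolve_left two_ne_zero
      have h7 := (hball t ht).2.2 _ h6
      have h8 : ((2 : ℝ) • B (g (ℓ t))) (deriv (fun t => g (ℓ t)) t) = 0 := by
        rw [_root_.smul_apply, h7, smul_zero]
      rw [h8] at h2
      exact h2
    intro t ht
    have := Metric.isOpen_ball.is_const_of_deriv_eq_zero
      (convex_ball (0 : ℝ) ε).isPreconnected
      (fun s hs => (hcomp s hs).differentiableAt.differentiableWithinAt)
      (fun s hs => (hcomp s hs).deriv) ht (Metric.mem_ball_self hε)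
    simp only [hℓ0, hgp] at this
    exact this

section Frameworks

variable {V : Type*} {d : ℕ}

/-- On the diagonal this symmetric form gives the squared edge lengths, and for fixed first argument
its kernel is the space of infinitesimal motions. -/
noncomputable def edgeForm [Fintype V] (adj : V → V → Prop) :
    (V → E d) →L[ℝ] (V → E d) →L[ℝ] (V × V → ℝ) :=
  LinearMap.toContinuousLinearMap
    ((LinearMap.toContinuousLinearMap : ((V → E d) →ₗ[ℝ] (V × V → ℝ)) ≃ₗ[ℝ] _).toLinearMap ∘ₗ
      LinearMap.mk₂ ℝ (fun z q e => inner ℝ (bonds adj z e.1 e.2) (q e.1 - q e.2))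
        (by
          intro a b q; funext e
          simp only [bonds, Pi.add_apply]
          split_ifs
          · rw [← inner_add_left]; congr 1; abel
          · simp)
        (by
          intro c a q; funext e
          simp only [bonds, Pi.smul_apply, smul_eq_mul]
          split_ifs
          · rw [← smul_sub, real_inner_smul_left]
          · simp)
        (by
          intro a q r; funext e
          simp only [Pi.add_apply]
          rw [← inner_add_right]; congr 1; abel)
        (by
          intro c a q; funext e
          simp only [Pi.smul_apply, smul_eq_mul]
          rw [← smul_sub, real_inner_smul_right]))

theorem edgeForm_apply [Fintype V] (adj : V → V → Prop) (z q : V → E d) (e : V × V) :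
    edgeForm adj z q e = inner ℝ (bonds adj z e.1 e.2) (q e.1 - q e.2) := rfl

theorem edgeForm_apply_of_adj [Fintype V] {adj : V → V → Prop} (z q : V → E d) {x y : V}
    (h : adj x y) : edgeForm adj z q (x, y) = inner ℝ (z x - z y) (q x - q y) := by
  rw [edgeForm_apply, bonds, if_pos h]

theorem ker_edgeForm [Fintype V] (adj : V → V → Prop) (z : V → E d) :
    LinearMap.ker (edgeForm adj z : (V → E d) →ₗ[ℝ] (V × V → ℝ)) = motions (bonds adj z) := by
  ext q
  rw [LinearMap.mem_ker, mem_motions]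
  change edgeForm adj z q = 0 ↔ _
  rw [funext_iff, Prod.forall]
  rfl

/-- A generic rigid framework is infinitesimally rigid (Asimow and Roth). -/
theorem IsRigidFramework.inner_eq_zero [Fintype V] [DecidableEq V] {G : SimpleGraph V}
    {p : V → E d} (hG : IsRigidFramework G p) (hp : IsGeneric p) {q : V → E d}
    (hq : ∀ x y, G.Adj x y → inner ℝ (p x - p y) (q x - q y) = 0) (x y : V) :
    inner ℝ (p x - p y) (q x - q y) = 0 := by
  have hsym : ∀ a b : V → E d, edgeForm G.Adj a b = edgeForm G.Adj b a := by
    intro a b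
    funext e
    simp only [edgeForm_apply, bonds]
    split_ifs
    · exact real_inner_comm _ _
    · simp
  obtain ⟨γ, ε, hε, hγ0, hγd, hγc, hγ⟩ := exists_curve_in_fibre (edgeForm G.Adj) hsym p
    (fun z => by
      rw [ker_edgeForm, ker_edgeForm]
      exact finrank_motions_le G.Adj z p hp) q (by
      have : q ∈ LinearMap.ker (edgeForm G.Adj p : (V → E d) →ₗ[ℝ] (V × V → ℝ)) := by
        rw [ker_edgeForm, mem_motions_bonds]; exact hq
      exact this)
  -- The curve restricted to the segment from `0` to `t` and reparametrised by the unit interval is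
  -- a motion of the framework, so its end is congruent to `p`. All distances are therefore constant
  -- along the curve, and differentiating at `0` gives the claim.
  have hcong : ∀ t ∈ Metric.ball (0 : ℝ) ε, IsCongruent p (γ t) := by
    intro t ht
    rw [mem_ball_zero_iff, Real.norm_eq_abs] at ht
    have hst : ∀ s : unitInterval, (s : ℝ) * t ∈ Metric.ball (0 : ℝ) ε := by
      intro s
      rw [mem_ball_zero_iff, Real.norm_eq_abs, abs_mul, abs_of_nonneg s.2.1]
      exact (mul_le_of_le_one_left (abs_nonneg t) s.2.2).trans_lt ht
    have := hG (fun s => γ (s * t)) (hγc.comp_continuous (by fun_prop) hst) (by simp [hγ0])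
      (fun s x y hxy => by
        have h1 := congrFun (hγ _ (hst s)) (x, y)
        rw [edgeForm_apply_of_adj _ _ hxy, edgeForm_apply_of_adj _ _ hxy,
          real_inner_self_eq_norm_sq, real_inner_self_eq_norm_sq] at h1
        rw [dist_eq_norm, dist_eq_norm]
        exact (sq_eq_sq₀ (norm_nonneg _) (norm_nonneg _)).1 h1)
    simpa using this
  have hd1 : ∀ z, HasDerivAt (fun t => γ t z) (q z) 0 := fun z => hasDerivAt_pi.1 hγd z
  have hd2 := ((hd1 x).sub (hd1 y)).inner ℝ ((hd1 x).sub (hd1 y))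
  have hd3 : HasDerivAt (fun t => inner ℝ (γ t x - γ t y) (γ t x - γ t y)) 0 (0 : ℝ) := by
    refine (hasDerivAt_const (0 : ℝ) (inner ℝ (p x - p y) (p x - p y))).congr_of_eventuallyEq ?_
    filter_upwards [Metric.ball_mem_nhds (0 : ℝ) hε] with t ht
    obtain ⟨φ, hφ⟩ := hcong t ht
    rw [hφ x, hφ y, real_inner_self_eq_norm_sq, real_inner_self_eq_norm_sq, ← dist_eq_norm,
      ← dist_eq_norm, φ.isometry.dist_eq]
  have hd4 := hd2.unique hd3
  simp only [Pi.sub_apply, hγ0] at hd4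
  rw [real_inner_comm (p x - p y) (q x - q y)] at hd4
  linarith

/-! ### Dimension counts -/

/-- Coordinates are the entries of the skew matrix on one side of the diagonal, together with the
translation: `d.choose 2 + d` in all. -/
theorem finrank_trivialMotions (d : ℕ) :
    Module.finrank ℝ (trivialMotions d) = (d + 1).choose 2 := by
  let ι := Σ i : Fin d, Fin i
  let lt : ι → Fin d := fun s => ⟨s.2, s.2.2.trans s.1.2⟩
  let b : Fin d → E d := fun i => EuclideanSpace.single i 1
  let Ψ : trivialMotions d →ₗ[ℝ] (ι → ℝ) × E d :=
    { toFun := fun τ => (fun s => τ.1.1 (b s.1) (lt s), τ.1.2)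
      map_add' := by intro a c; rfl
      map_smul' := by intro a c; rfl }
  have hskew : ∀ τ ∈ trivialMotions d, ∀ i j, τ.1 (b i) j = - τ.1 (b j) i := by
    intro τ hτ i j
    have h := inner_trivialMotion hτ (b i) (b j)
    simpa [b, EuclideanSpace.inner_single_right, EuclideanSpace.inner_single_left] using h
  have hinj : Function.Injective Ψ := by
    rw [← LinearMap.ker_eq_bot, LinearMap.ker_eq_bot']
    rintro ⟨τ, hτ⟩ h0
    have h1 : (fun s : ι => τ.1 (b s.1) (lt s)) = 0 := congrArg Prod.fst h0
    have h2 : τ.2 = 0 := congrArg Prod.snd h0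
    have h3 : ∀ i j : Fin d, j < i → τ.1 (b i) j = 0 := fun i j hij =>
      congrFun h1 (⟨i, ⟨j, hij⟩⟩ : ι)
    refine Subtype.ext (Prod.ext ?_ h2)
    refine (EuclideanSpace.basisFun (Fin d) ℝ).toBasis.ext fun i => ?_
    ext j
    have : τ.1 (b i) j = 0 := by
      rcases lt_trichotomy j i with h | h | h
      · exact h3 i j h
      · subst h
        have := hskew τ hτ j j
        linarith
      · rw [hskew τ hτ, h3 j i h, neg_zero]
    simpa [b] using this
  have hsurj : Function.Surjective Ψ := by
    rintro ⟨f, t⟩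
    let A : Fin d → Fin d → ℝ := fun i j =>
      if h : j < i then f ⟨i, ⟨j, h⟩⟩ else if h : i < j then - f ⟨j, ⟨i, h⟩⟩ else 0
    have hA : ∀ i j, A i j = - A j i := by
      intro i j
      simp only [A]
      rcases lt_trichotomy j i with h | h | h
      · simp [h, h.not_gt]
      · simp [h]
      · simp [h, h.not_gt]
    let M : E d →ₗ[ℝ] E d := (EuclideanSpace.basisFun (Fin d) ℝ).toBasis.constr ℝ
      fun i => WithLp.toLp 2 (A i)
    have hM : ∀ i, M (b i) = WithLp.toLp 2 (A i) := by
      intro i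
      simp [b, M]
    have hMx : ∀ x : E d, M x = ∑ i, x i • (WithLp.toLp 2 (A i) : E d) := by
      intro x
      simp [M, Module.Basis.constr_apply_fintype]
    refine ⟨⟨(M, t), fun x => ?_⟩, ?_⟩
    · change inner ℝ (M x) x = 0
      have h1 : inner ℝ (M x) x = ∑ i, ∑ j, x i * A i j * x j := by
        rw [hMx, sum_inner]
        refine Finset.sum_congr rfl fun i _ => ?_
        rw [real_inner_smul_left, inner_eq_sum, Finset.mul_sum]
        exact Finset.sum_congr rfl fun j _ => by ring
      have h2 : ∑ i, ∑ j, x i * A i j * x j = - ∑ i, ∑ j, x i * A i j * x j := by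
        conv_lhs => rw [Finset.sum_comm]
        rw [← Finset.sum_neg_distrib]
        refine Finset.sum_congr rfl fun i _ => ?_
        rw [← Finset.sum_neg_distrib]
        refine Finset.sum_congr rfl fun j _ => ?_
        rw [hA j i]; ring
      rw [h1]; linarith
    · refine Prod.ext ?_ rfl
      funext s
      change M (b s.1) (lt s) = f s
      rw [hM]
      have : lt s < s.1 := s.2.2
      simp [A, this, lt]
  rw [(LinearEquiv.ofBijective Ψ ⟨hinj, hsurj⟩).finrank_eq, Module.finrank_prod,
    Module.finrank_fintype_fun_eq_card, finrank_euclideanSpace_fin]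
  simp only [ι, Fintype.card_sigma, Fintype.card_fin]
  rw [Fin.sum_univ_eq_sum_range (fun i => i), Finset.sum_range_id, ← Nat.choose_two_right,
    Nat.choose_succ_succ' d 1, Nat.choose_one_right, add_comm]

theorem rigidityMatrix_mulVec [Fintype V] [DecidableEq V] (G : SimpleGraph V) (p q : V → E d)
    {x y : V} (h : s(x, y) ∈ G.edgeSet) :
    (rigidityMatrix G p).mulVec (flattenEquiv V d q) ⟨s(x, y), h⟩ =
      inner ℝ (p x - p y) (q x - q y) := by
  simp only [Matrix.mulVec, dotProduct, rigidityMatrix, Matrix.of_apply, flattenEquiv_apply,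
    Fintype.sum_prod_type, add_mul, Finset.sum_add_distrib, ite_mul, zero_mul, Sym2.lift_mk]
  rw [Finset.sum_comm, Finset.sum_comm (f := fun z i => if z = y then _ else _)]
  simp only [Finset.sum_ite_eq', Finset.mem_univ, if_true]
  rw [inner_eq_sum, ← Finset.sum_add_distrib]
  refine Finset.sum_congr rfl fun i _ => ?_
  simp only [PiLp.sub_apply]
  ring

theorem finrank_motions_add_rank_rigidityMatrix [Fintype V] [DecidableEq V] (G : SimpleGraph V)
    (p : V → E d) : Module.finrank ℝ (motions (bonds G.Adj p)) + (rigidityMatrix G p).rank =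
      d * Fintype.card V := by
  have h1 : motions (bonds G.Adj p) = (LinearMap.ker (rigidityMatrix G p).mulVecLin).map
      ((flattenEquiv V d).symm : (V × Fin d → ℝ) →ₗ[ℝ] (V → E d)) := by
    rw [Submodule.map_equiv_eq_comap_symm]
    ext q
    simp only [mem_motions_bonds, LinearEquiv.symm_symm, Submodule.mem_comap, LinearMap.mem_ker,
      Matrix.mulVecLin_apply, LinearEquiv.coe_coe]
    rw [funext_iff]
    constructor
    · rintro h ⟨e, he⟩
      induction e with
      | h x y =>
        rw [rigidityMatrix_mulVec]
        exact h x y he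
    · intro h x y hxy
      rw [← rigidityMatrix_mulVec G p q (show s(x, y) ∈ G.edgeSet from hxy)]
      exact h _
  rw [h1, LinearEquiv.finrank_map_eq]
  have := LinearMap.finrank_range_add_finrank_ker (rigidityMatrix G p).mulVecLin
  rw [Module.finrank_fintype_fun_eq_card, Fintype.card_prod, Fintype.card_fin] at this
  rw [mul_comm, ← this, add_comm]
  rfl

end Frameworks

/-! ### From multisets and graphs to chains modulo two -/

section Translation

variable {α : Type*} [DecidableEq α] {k : ℕ}

theorem vertices_val (S : Finset (Finset α)) : vertices S.val = verts S := by
  rw [vertices, Finset.val_toFinset, verts]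

theorem isSimplicialCycle_val_iff {S : Finset (Finset α)} :
    IsSimplicialCycle k S.val ↔ IsCyc k S := by
  refine and_congr Iff.rfl ?_
  have hodd : ∀ F, Odd (Multiset.card (S.val.filter fun U => F ⊆ U)) ↔ bd S F ≠ 0 := by
    intro F
    rw [bd_eq_card, ne_eq, ZMod.natCast_eq_zero_iff_even, Nat.not_even_iff_odd]
    rfl
  rw [Set.eq_empty_iff_forall_notMem]
  refine forall_congr' fun F => ?_
  rw [boundary, Set.mem_ofPred_eq, hodd, vertices_val]
  constructor
  · intro h hF
    by_contra hne
    obtain ⟨U, hU, hFU⟩ := exists_of_bd_ne_zero hne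
    exact h ⟨hFU.trans (subset_verts hU), hF, hne⟩
  · rintro h ⟨-, hF, hne⟩
    exact hne (h hF)

theorem IsSimplicialCircuit.isCirc {S : Finset (Finset α)} (h : IsSimplicialCircuit k S.val) :
    IsCirc k S := by
  obtain ⟨h0, hcyc, hmin⟩ := h
  refine ⟨?_, isSimplicialCycle_val_iff.1 hcyc, fun D hD hne hDc => ?_⟩
  · rw [Finset.nonempty_iff_ne_empty]
    rintro rfl
    exact h0 rfl
  · by_contra hDS
    refine hmin D.val (Finset.val_lt_iff.2 (hD.ssubset_of_ne hDS)) ?_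
      (isSimplicialCycle_val_iff.2 hDc)
    rw [ne_eq, Finset.val_eq_zero]
    exact hne.ne_empty

theorem isSimplicialCycle_replicate {U : Finset α} (hU : U.card = k + 1) :
    IsSimplicialCycle k (Multiset.replicate 2 U) := by
  refine ⟨fun V hV => Multiset.eq_of_mem_replicate hV ▸ hU, ?_⟩
  rw [Set.eq_empty_iff_forall_notMem]
  rintro F ⟨-, -, hF⟩
  by_cases hFU : F ⊆ U
  · rw [Multiset.filter_eq_self.2 fun V hV => Multiset.eq_of_mem_replicate hV ▸ hFU,
      Multiset.card_replicate] at hF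
    exact absurd hF (by decide)
  · rw [Multiset.filter_eq_nil.2 fun V hV => Multiset.eq_of_mem_replicate hV ▸ hFU] at hF
    simp at hF

/-- A circuit on more than `k + 1` vertices has no repeated simplices. -/
theorem IsSimplicialCircuit.nodup {S : Multiset (Finset α)} (h : IsSimplicialCircuit k S)
    (hcard : k + 1 < (vertices S).card) : S.Nodup := by
  rw [Multiset.nodup_iff_le]
  intro U hU
  have hU' : Multiset.replicate 2 U ≤ S := hU
  have hUS : U ∈ S := Multiset.mem_of_le hU' (Multiset.mem_replicate.2 ⟨by norm_num, rfl⟩)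
  have hUcard := h.2.1.1 U hUS
  -- Two copies of a simplex already form a cycle, so they would be the whole circuit, which would
  -- then have only `k + 1` vertices.
  rcases hU'.lt_or_eq with hlt | heq
  · refine h.2.2 _ hlt ?_ (isSimplicialCycle_replicate hUcard)
    intro h0
    have := congrArg Multiset.card h0
    simp at this
  · have hle : vertices S ⊆ U := by
      intro a ha
      rw [← heq, vertices, Finset.mem_biUnion] at ha
      obtain ⟨V, hV, haV⟩ := ha
      rw [Multiset.mem_toFinset] at hV
      exact Multiset.eq_of_mem_replicate hV ▸ haV
    have := Finset.card_le_card hle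
    omega

theorem IsKConnected.connectedAfter {S : Finset (Finset α)} {n : ℕ}
    (h : IsKConnected (n + 1) (graph S.val)) : ConnectedAfter S n := by
  classical
  rintro X hX W ⟨a, ha, haX, hWa⟩ hW b hb hbX
  rw [← vertices_val] at ha hb
  have hcon := h.2 (X.subtype (· ∈ vertices S.val)) (by
    have : (X.subtype (· ∈ vertices S.val)).card ≤ X.card := by
      rw [Finset.card_subtype]; exact Finset.card_filter_le _ _
    omega)
  have hmem : ∀ c : {x // x ∈ vertices S.val}, (c : α) ∉ X →
      c ∈ {x | x ∉ X.subtype (· ∈ vertices S.val)} := by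
    intro c hc
    simpa using hc
  obtain ⟨walk⟩ := hcon.preconnected ⟨⟨a, ha⟩, hmem _ haX⟩ ⟨⟨b, hb⟩, hmem _ hbX⟩
  have key : ∀ c e : {x // x ∈ {x | x ∉ X.subtype (· ∈ vertices S.val)}},
      ((graph S.val).induce {x | x ∉ X.subtype (· ∈ vertices S.val)}).Walk c e →
      W (c : {x // x ∈ vertices S.val}) → W (e : {x // x ∈ vertices S.val}) := by
    intro c e walk
    induction walk with
    | nil => exact id
    | @cons c e f hadj _ ih =>
      intro hc
      refine ih (hW _ _ ?_ ?_ ?_ hc)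
      · simpa using c.2
      · simpa using e.2
      · obtain ⟨-, U, hU, h1, h2⟩ := hadj
        exact ⟨U, hU, h1, h2⟩
  exact key _ _ walk hWa

end Translation

/-! ### The coincident realisation -/

section Main

variable {α : Type*} [DecidableEq α] {j : ℕ}

/-- Rigidity of the graph of a circuit at a point configuration where two vertices coincide. -/
theorem IsCirc.infRigidOn_coincident (hj : 2 ≤ j) {S : Finset (Finset α)} (hS : IsCirc (j + 1) S)
    {u v : α} (huv : u ≠ v) (hu : u ∈ verts S) (hv : v ∈ verts S) {p : α → E (j + 2)}
    (hpuv : p u = p v) (hgen : ∀ A ⊆ verts S, (u ∈ A → v ∉ A) → GenOn p A)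
    (hcard : j + 4 ≤ (verts S).card) (hconn : ConnectedAfter S (j + 2))
    (hcontract : ∀ q : α → E (j + 2), q u = q v →
      (∀ U ∈ S, ∀ a ∈ U, ∀ b ∈ U, inner ℝ (p a - p b) (q a - q b) = 0) →
      ∀ a ∈ (verts S).erase v, ∀ b ∈ (verts S).erase v, inner ℝ (p a - p b) (q a - q b) = 0) :
    InfRigidOn (fun a b => ∃ U ∈ S, a ∈ U ∧ b ∈ U) (verts S) p := by
  intro q hq
  have hflex : ∀ U ∈ S, ∀ a ∈ U, ∀ b ∈ U, inner ℝ (p a - p b) (q a - q b) = 0 :=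
    fun U hU a ha b hb => hq a (subset_verts hU ha) b (subset_verts hU hb) ⟨U, hU, ha, hb⟩
  by_cases hcommon : (commonNbrs S u v).card ≤ j + 1
  · exact hS.isBody_of_card_commonNbrs_le hj huv hgen hflex hcommon hcard hconn
  -- With `d = j + 2` common neighbours the velocities of `u` and `v` must agree, and the rigidity
  -- of the contraction applies.
  · obtain ⟨A, hA, hAcard⟩ := Finset.exists_subset_card_eq
      (show j + 2 ≤ (commonNbrs S u v).card by omega)
    have huA : u ∉ A := fun h => (mem_commonNbrs.1 (hA h)).1 rfl
    have hvA : v ∉ A := fun h => (mem_commonNbrs.1 (hA h)).2.1 rfl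
    have hgenA : GenOn p (insert u A) := by
      refine hgen _ (Finset.insert_subset hu (hA.trans (Finset.filter_subset _ _))) ?_
      intro _ h
      rcases Finset.mem_insert.1 h with h | h
      · exact huv h.symm
      · exact hvA h
    have hquv : q u = q v := by
      rw [← sub_eq_zero]
      refine hgenA.eq_zero_of_inner (by rw [Finset.card_insert_of_notMem huA, hAcard])
        (Finset.mem_insert_self u A) fun a ha => ?_
      rcases Finset.mem_insert.1 ha with rfl | ha
      · simp
      · obtain ⟨-, -, ⟨U, hU, h1, h2⟩, ⟨U', hU', h3, h4⟩⟩ := mem_commonNbrs.1 (hA ha)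
        have e1 := hflex U hU a h1 u h2
        have e2 := hflex U' hU' a h3 v h4
        rw [← hpuv] at e2
        have e : q u - q v = (q a - q v) - (q a - q u) := by abel
        rw [e, inner_sub_right, e1, e2, sub_zero]
    obtain ⟨τ, hτ, hτq⟩ := (hgen ((verts S).erase v) (Finset.erase_subset _ _)
      fun _ => Finset.notMem_erase _ _).isBody
      (by rw [Finset.card_erase_of_mem hv]; omega) (hcontract q hquv hflex)
    refine ⟨τ, hτ, fun a ha => ?_⟩
    by_cases hav : a = v
    · rw [hav, ← hquv, ← hpuv]
      exact hτq u (Finset.mem_erase.2 ⟨huv, hu⟩)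
    · exact hτq a (Finset.mem_erase.2 ⟨hav, ha⟩)

theorem exists_coincident_of_finset (hj : 2 ≤ j) (S : Finset (Finset α))
    (hS : IsCirc (j + 1) S) (u v : {x : α // x ∈ vertices S.val}) (huv : u ≠ v)
    (hconn : IsKConnected (j + 3) (graph S.val))
    (hrigid : IsRigid (j + 2) (contract (graph S.val) u v)) :
    ∃ p : {x : α // x ∈ vertices S.val} → E (j + 2),
      p u = p v ∧ IsInfinitesimallyRigid (graph S.val) p := by
  classical
  obtain ⟨p₀, hp₀, hrig⟩ := hrigid
  obtain ⟨p, hpv, hp⟩ : ∃ p : {x : α // x ∈ vertices S.val} → E (j + 2),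
      p v = p₀ ⟨u, huv⟩ ∧ ∀ x (hx : x ≠ v), p x = p₀ ⟨x, hx⟩ :=
    ⟨fun x => if hx : x ≠ v then p₀ ⟨x, hx⟩ else p₀ ⟨u, huv⟩, by simp, fun x hx => by simp [hx]⟩
  have hpuv : p u = p v := by rw [hpv, hp u huv]
  refine ⟨p, hpuv, ?_⟩
  have hv : vertices S.val = verts S := vertices_val S
  obtain ⟨P, hP⟩ : ∃ P : α → E (j + 2), ∀ x : {x : α // x ∈ vertices S.val}, P x = p x :=
    ⟨fun a => if h : a ∈ vertices S.val then p ⟨a, h⟩ else 0, fun x => by simp [x.2]⟩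
  have hcard : j + 4 ≤ (verts S).card := by
    have := hconn.1
    rw [Nat.card_eq_fintype_card, Fintype.card_coe, hv] at this
    omega
  have hne : (u : α) ≠ v := fun h => huv (Subtype.ext h)
  have hgen : ∀ A ⊆ verts S, ((u : α) ∈ A → (v : α) ∉ A) → GenOn P A := by
    intro A hA hA'
    -- The map `f` below replaces `v` by `u`. It is injective on a set not containing both, so the
    -- coordinates on `A` form a subfamily of those of the generic `p₀`.
    have hmem : ∀ a : A, (a : α) ∈ vertices S.val := fun a => hv ▸ hA a.2
    let f : A → {x : {x : α // x ∈ vertices S.val} // x ≠ v} := fun a =>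
      if h : (⟨a, hmem a⟩ : {x : α // x ∈ vertices S.val}) = v then ⟨u, huv⟩ else ⟨⟨a, hmem a⟩, h⟩
    have hf : Function.Injective f := by
      intro a b hab
      simp only [f] at hab
      split_ifs at hab with h1 h2 h2
      · have h3 := congrArg Subtype.val (h1.trans h2.symm)
        exact Subtype.ext h3
      · exfalso
        have h3 : (u : α) = b := congrArg (fun x => ((x.1).1 : α)) hab
        have h4 : (a : α) = v := congrArg Subtype.val h1
        exact hA' (h3 ▸ b.2) (h4 ▸ a.2)
      · exfalso
        have h3 : (a : α) = u := congrArg (fun x => ((x.1).1 : α)) hab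
        have h4 : (b : α) = v := congrArg Subtype.val h2
        exact hA' (h3 ▸ a.2) (h4 ▸ b.2)
      · have h3 := congrArg (fun x => ((x.1).1 : α)) hab
        exact Subtype.ext h3
    have hcomp := AlgebraicIndependent.comp hp₀ (Prod.map f id) (hf.prodMap Function.injective_id)
    have e : (fun i : A × Fin (j + 2) => P i.1 i.2) =
        (fun i : {x : {x : α // x ∈ vertices S.val} // x ≠ v} × Fin (j + 2) => p₀ i.1 i.2) ∘
          Prod.map f id := by
      funext i
      have h1 : P i.1 = p ⟨i.1, hmem i.1⟩ := hP ⟨i.1, hmem i.1⟩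
      have h2 : p ⟨i.1, hmem i.1⟩ = p₀ (f i.1) := by
        simp only [f]
        split_ifs with h
        · rw [h, hpv]
        · exact hp _ h
      rw [h1, h2]
      rfl
    unfold GenOn
    rw [e]
    exact hcomp
  have hmain := hS.infRigidOn_coincident hj hne (hv ▸ u.2) (hv ▸ v.2)
    (by rw [hP, hP, hpuv]) hgen hcard hconn.connectedAfter (by
      intro q hquv hflex a ha b hb
      rw [Finset.mem_erase, ← hv] at ha hb
      have hav : (⟨a, ha.2⟩ : {x : α // x ∈ vertices S.val}) ≠ v :=
        fun h => ha.1 (congrArg Subtype.val h)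
      have hbv : (⟨b, hb.2⟩ : {x : α // x ∈ vertices S.val}) ≠ v :=
        fun h => hb.1 (congrArg Subtype.val h)
      have hPa : ∀ x : {x : {x : α // x ∈ vertices S.val} // x ≠ v}, p₀ x = P x := by
        intro x; rw [hP, hp x.1 x.2]
      have hPv : P v = P u := by rw [hP, hP, hpuv]
      -- As `u` and `v` share position and velocity, an edge of the contraction at `u` that comes
      -- from `v` imposes the same condition as the original edge.
      have hE : ∀ x y, (contract (graph S.val) u v).Adj x y →
          inner ℝ (p₀ x - p₀ y) (q x - q y) = 0 := by
        rintro x y ⟨-, h | ⟨h1, h2⟩ | ⟨h1, h2⟩⟩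
        · obtain ⟨-, U, hU, hx, hy⟩ := h
          rw [hPa, hPa]
          exact hflex U hU _ hx _ hy
        · obtain ⟨-, U, hU, hx, hy⟩ := h2
          rw [hPa, hPa, h1, hquv, ← hPv]
          exact hflex U hU _ hx _ hy
        · obtain ⟨-, U, hU, hx, hy⟩ := h2
          rw [hPa, hPa, h1, hquv, ← hPv]
          exact hflex U hU _ hy _ hx
      have := hrig.inner_eq_zero hp₀ (q := fun x => q x) hE ⟨_, hav⟩ ⟨_, hbv⟩
      rwa [hPa, hPa] at this)
  have hle : motions (bonds (graph S.val).Adj p) ≤ LinearMap.range (trivialVelocities p) := by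
    intro q hq
    rw [mem_motions_bonds] at hq
    obtain ⟨Q, hQ⟩ : ∃ Q : α → E (j + 2), ∀ x : {x : α // x ∈ vertices S.val}, Q x = q x :=
      ⟨fun a => if h : a ∈ vertices S.val then q ⟨a, h⟩ else 0, fun x => by simp [x.2]⟩
    obtain ⟨τ, hτ, hτq⟩ := hmain Q (by
      rintro a ha b hb ⟨U, hU, haU, hbU⟩
      rw [← hv] at ha hb
      by_cases hab : a = b
      · simp [hab]
      · have := hq ⟨a, ha⟩ ⟨b, hb⟩ ⟨fun h => hab (congrArg Subtype.val h), U, hU, haU, hbU⟩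
        rwa [← hP, ← hP, ← hQ, ← hQ] at this)
    refine ⟨⟨τ, hτ⟩, ?_⟩
    funext x
    have := hτq x (hv ▸ x.2)
    rw [hQ, hP] at this
    exact this.symm
  have hinj : Function.Injective (trivialVelocities p) := by
    rw [← LinearMap.ker_eq_bot, LinearMap.ker_eq_bot']
    intro τ hτ
    refine Subtype.ext ((hgen ((verts S).erase v) (Finset.erase_subset _ _)
      fun _ => Finset.notMem_erase _ _).trivialMotion_eq_zero (by omega)
      (by rw [Finset.card_erase_of_mem (hv ▸ v.2)]; omega) τ.2 fun a ha => ?_)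
    have ha' : a ∈ vertices S.val := hv ▸ Finset.mem_of_mem_erase ha
    have h1 := congrFun hτ ⟨a, ha'⟩
    have h2 : P a = p ⟨a, ha'⟩ := hP ⟨a, ha'⟩
    rw [h2]
    exact h1
  have heq : Module.finrank ℝ (motions (bonds (graph S.val).Adj p)) = (j + 2 + 1).choose 2 := by
    rw [le_antisymm hle (range_trivialVelocities_le _ _), LinearMap.finrank_range_of_inj hinj,
      finrank_trivialMotions]
  have hrank := finrank_motions_add_rank_rigidityMatrix (graph S.val) p
  have hn : j + 2 ≤ Fintype.card {x : α // x ∈ vertices S.val} := by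
    rw [Fintype.card_coe, hv]; omega
  rw [IsInfinitesimallyRigid, if_pos hn]
  omega

end Main

end SimplicialRigidity

theorem mainTheorem9 {α : Type*} [DecidableEq α] (k : ℕ) (hk : 3 ≤ k)
    (S : Multiset (Finset α)) (hS : SimplicialRigidity.IsSimplicialCircuit k S)
    (u v : {x : α // x ∈ SimplicialRigidity.vertices S}) (huv : u ≠ v)
    (hconn : SimplicialRigidity.IsKConnected (k + 2) (SimplicialRigidity.graph S))
    (hrigid : SimplicialRigidity.IsRigid (k + 1)
      (SimplicialRigidity.contract (SimplicialRigidity.graph S) u v)) :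
    ∃ p : {x : α // x ∈ SimplicialRigidity.vertices S} → EuclideanSpace ℝ (Fin (k + 1)),
      p u = p v ∧
        SimplicialRigidity.IsInfinitesimallyRigid (SimplicialRigidity.graph S) p := by
  -- Connectivity gives more than `k + 2` vertices, which excludes the circuit made of one doubled
  -- simplex.
  have hnodup : S.Nodup := hS.nodup (by
    have := hconn.1
    rw [Nat.card_eq_fintype_card, Fintype.card_coe] at this
    omega)
  obtain ⟨T, rfl⟩ : ∃ T : Finset (Finset α), T.val = S := ⟨⟨S, hnodup⟩, rfl⟩
  -- The shift makes vertex links `j`-cycles, and `k ≥ 3` becomes the bound `j ≥ 2` under which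
  -- cones over circuits are rigid.
  obtain ⟨j, rfl⟩ : ∃ j, k = j + 1 := ⟨k - 1, by omega⟩
  exact SimplicialRigidity.exists_coincident_of_finset (by omega) T hS.isCirc u v huv hconn hrigid
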